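/- **Setting.** For every security parameter $\kappa$ fix a prime $q$ with $\kappa=\lfloor\log_2 q\rfloor$ (for $\kappa\ge 1$). $\mathrm{Setup}(1^\kappa)$ samples, from an arbitrary fixed distribution, a cyclic group $\mathbb G$ of order $q$ with a generator $g$ (descriptions and encoded elements have length polynomial in $\kappa$), and then an independent uniform generator $h$ of $\mathbb G$; $\mathrm{Com}(m,r)=g^mh^r$ is the Pedersen commitment, $m,r\in\mathbb Z_q$. The numbers $n$ of clients, $K\ge1$ of provers and $n_b\ge1$ of private bits per prover are polynomially bounded in $\kappa$. "Polynomial time" means non-uniform probabilistic polynomial time: families of circuits of polynomial size, with polynomially many random bits and random elements of $\mathbb Z_q$, whose gates are Boolean gates, arithmetic of $\mathbb Z_q$, operations of $\mathbb G$, and conversions between these and bit strings. The discrete-log advantage $\mathrm{Adv}^{\mathrm{DL}}_B(\kappa)$ of $B$ is the probability that $B(g^x)=x$ for a group sampled as above and uniform $x\in\mathbb Z_q$. **Functionality.** On inputs $X_1,\dots,X_K\in\mathbb Z_q$, $\mathcal M_{\mathrm{Bin}}$ samples independent $\Delta_k\sim\mathrm{Binomial}(n_b,1/2)$, outputs $y=\sum_k(X_k+\Delta_k)\in\mathbb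 Z_q$ publicly and $\Delta_k$ (mod $q$) to prover $k$. For $x\in\mathbb Z_q^n$ with additive shares $\sum_k [x_i]_k=x_i$, $\mathcal M_{\mathrm{Bin}}(x)$ denotes it on $X_k=\sum_{i:\,x_i\in\{0,1\}}[x_i]_k$. **Protocol $\Pi_{\mathrm{Bin}}$** (rounds run in parallel for all provers). *Oracles:* the bit-proof oracle $\mathcal O_{\mathrm{OR}}$, given $c$ from the verifier and an opening $(v,s)$ from the other party, answers whether $v\in\{0,1\}$ and $c=\mathrm{Com}(v,s)$; $\mathcal O_{\mathrm{morra}}$ returns uniform public bits. 1. Client $i$ publishes $c_{i,k}=\mathrm{Com}([x_i]_k,r_{i,k})$ with uniform $r_{i,k}$ for all $k$ and sends $([x_i]_k,r_{i,k})$ to prover $k$; client $i$ is valid if $\mathcal O_{\mathrm{OR}}$ accepts $\prod_kc_{i,k}$ with the opening $(x_i,\sum_kr_{i,k})$. Only valid clients are used below. 2. Prover $k$ samples uniform $v_{j,k}\in\{0,1\}$, $s_{j,k}\in\mathbb Z_q$ ($j\le n_b$) and publishes $c'_{j,k}=\mathrm{Com}(v_{j,k},s_{j,k})$. The verifier aborts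 (rejects) unless $\mathcal O_{\mathrm{OR}}$ accepts all of them. 3. $\mathcal O_{\mathrm{morra}}$ returns bits $b_{j,k}$. Put $\hat v_{j,k}=1-v_{j,k}$, $\hat s_{j,k}=-s_{j,k}$, $\hat c'_{j,k}=\mathrm{Com}(1,0)\,c_{j,k}'^{-1}$ if $b_{j,k}=1$, and $\hat v_{j,k}=v_{j,k}$, $\hat s_{j,k}=s_{j,k}$, $\hat c'_{j,k}=c'_{j,k}$ otherwise. 4. Prover $k$ sends $y_k=\sum_i[x_i]_k+\sum_j\hat v_{j,k}$ and $z_k=\sum_ir_{i,k}+\sum_j\hat s_{j,k}$. The verifier accepts if $\prod_ic_{i,k}\prod_j\hat c'_{j,k}=\mathrm{Com}(y_k,z_k)$ for all $k$. The published output is $y=\sum_ky_k$. **Theorem.** *Completeness.* For all $\kappa$, all $x\in\mathbb Z_q^n$ and all additive shares of $x$, when all parties are honest the verifier rejects with probability $0$, and $y$ is distributed exactly as the public output of $\mathcal M_{\mathrm{Bin}}(x)$. *Computational soundness.* Let a polynomial-time adversary $A$ with auxiliary input of polynomial length control the provers in an arbitrary set $I\subseteq[K]$ against an honest verifier; in each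 round it sees the public messages of the honest parties before it sends those of the corrupted provers. Let $x\in\mathbb Z_q^n$ (possibly depending on $\kappa$), with any additive shares. Call $y^*=\sum_{i:\,x_i\in\{0,1\}}x_i+\sum_{k,j}(v_{j,k}\oplus b_{j,k})$ the correct output, where for $k\in I$ the bit $v_{j,k}$ is the one with which $A$ opened its commitment to $\mathcal O_{\mathrm{OR}}$ (a value other than $1$ being read as $0$). Then (a) $y^*$ is distributed exactly as the public output of $\mathcal M_{\mathrm{Bin}}(x)$ and is independent of whether the verifier aborts before the public coins are tossed; (b) there is a polynomial-time $B$ with $$\Pr[\text{the verifier accepts and } y\ne y^*]\le \mathrm{Adv}^{\mathrm{DL}}_B(\kappa)\qquad\text{for all }\kappa;$$ (c) hence, if discrete logarithms are hard (every polynomial-time $B$ has negligible advantage), this probability is negligible. *Computational zero-knowledge.* Let a polynomial-time adversary control the verifier and the provers in a proper subset $I\subsetneq[K]$. It may submit arbitrary commitments to $\mathcal O_{\mathrm{OR}}$ in place of those of the honest provers, and may go on to $\mathcal O_{\mathrm{morra}}$ and the final message with any subset of the honest provers. The clients share their inputs with uniformly random additive shares. Then there is a polynomial-time simulator $\mathrm{Sim}$,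 depending only on the adversary and $I$, such that for all auxiliary inputs and all client inputs $x\in\mathbb Z_q^n$ with at least one $x_i\in\{0,1\}$ (not needed if only one prover is honest) the following two ensembles are computationally indistinguishable, where the start of the view consists of the public parameters, the adversary's coins and auxiliary input, the shares and commitment randomness of the corrupted provers, all $c_{i,k}$, and the set of valid clients: - the start of the view, the messages that the adversary receives from honest provers and oracles in $\Pi_{\mathrm{Bin}}$, and the noise values $\sum_j\hat v_{j,k}$ mod $q$ of the honest provers $k\notin I$ (defined by the coins $b_{j,k}$ also where the adversary stops before they are revealed); - the start of the view, the output of $\mathrm{Sim}$, and the noise values $\Delta_k$, $k\notin I$, of $\mathcal M_{\mathrm{Bin}}$; here $\mathrm{Sim}$ is given the start of the view, chooses the inputs $X_k$, $k\in I$, to $\mathcal M_{\mathrm{Bin}}$ (the honest provers' inputs being those of $\mathcal M_{\mathrm{Bin}}(x)$), and receives $y$ and $\Delta_k$, $k\in I$. For $K=1$ (so $I=\emptyset$) this is zero-knowledge of the single-curator protocol against a corrupted verifier. -/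

import Mathlib

open scoped BigOperators

/-! ### Negligible functions and polynomial bounds -/

/-- `f` is bounded by a polynomial in the security parameter. -/
def PolyBounded (f : ℕ → ℕ) : Prop :=
  ∃ p : Polynomial ℕ, ∀ κ, f κ ≤ p.eval κ

/-- `f` decays faster than the inverse of every polynomial. -/
def Negligible (f : ℕ → ℝ) : Prop :=
  Asymptotics.SuperpolynomialDecay Filter.atTop (fun κ : ℕ => (κ : ℝ)) f

/-! ### Prime order groups and their generation -/

/-- A cyclic group of order `q` with a distinguished generator, an injective encoding of its
elements (as natural numbers, i.e. as bit strings) and a bit string describing the group. -/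
structure PrimeGroup (q : ℕ) where
  carrier : Type
  [commGroup : CommGroup carrier]
  card_eq : Nat.card carrier = q
  gen : carrier
  gen_generates : ∀ a : carrier, a ∈ Subgroup.zpowers gen
  enc : carrier → ℕ
  enc_injective : Function.Injective enc
  descr : List Bool

attribute [instance] PrimeGroup.commGroup

/-- The group element encoded by `m`, and `1` if `m` encodes no element. -/
noncomputable def PrimeGroup.dec {q : ℕ} (P : PrimeGroup q) (m : ℕ) : P.carrier :=
  open Classical in if hm : ∃ a, P.enc a = m then hm.choose else 1

/-- A group generation algorithm. For the security parameter `κ` a prime `q κ` with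
`κ = ⌊log₂ (q κ)⌋` is fixed (`κ = 0` is no such logarithm), and a group of order `q κ`, with a
generator, is sampled. Descriptions and encoded elements have polynomial length. -/
structure GroupGen where
  q : ℕ → ℕ
  prime : ∀ κ, (q κ).Prime
  log_q : ∀ κ, 1 ≤ κ → Nat.log 2 (q κ) = κ
  Seed : ℕ → Type
  law : ∀ κ, PMF (Seed κ)
  grp : ∀ κ, Seed κ → PrimeGroup (q κ)
  enc_poly : ∃ p : Polynomial ℕ, ∀ κ ω a, (grp κ ω).enc a < 2 ^ p.eval κ
  descr_poly : ∃ p : Polynomial ℕ, ∀ κ ω, (grp κ ω).descr.length ≤ p.eval κ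

instance (S : GroupGen) (κ : ℕ) : Fact (S.q κ).Prime := ⟨S.prime κ⟩

/-! ### The machine model: circuits over bits, `ℤ_q` and the group -/

/-- The types of wires. -/
inductive Ty : Type
  | bit : Ty
  | fld : Ty
  | grp : Ty
  | prod : Ty → Ty → Ty
  | pow : Ty → ℕ → Ty

/-- The values that a wire can carry. -/
@[reducible] def Ty.El {q : ℕ} (P : PrimeGroup q) : Ty → Type
  | .bit => Bool
  | .fld => ZMod q
  | .grp => P.carrier
  | .prod a b => a.El P × b.El P
  | .pow a n => Fin n → a.El P

/-- Circuits with inputs of type `a` and outputs of type `b`. The syntax does not depend on the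
group, so that one circuit works for all groups that may be sampled. -/
inductive Circ : Ty → Ty → Type
  | id (a : Ty) : Circ a a
  | comp {a b c : Ty} (f : Circ a b) (g : Circ b c) : Circ a c
  | pair {a b c : Ty} (f : Circ a b) (g : Circ a c) : Circ a (.prod b c)
  | fst (a b : Ty) : Circ (.prod a b) a
  | snd (a b : Ty) : Circ (.prod a b) b
  | tup {a b : Ty} {n : ℕ} (f : Fin n → Circ a b) : Circ a (.pow b n)
  | proj (a : Ty) {n : ℕ} (i : Fin n) : Circ (.pow a n) a
  | bconst (a : Ty) (c : Bool) : Circ a .bit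
  | band : Circ (.prod .bit .bit) .bit
  | bnot : Circ .bit .bit
  | fconst (a : Ty) (c : ℤ) : Circ a .fld
  | fadd : Circ (.prod .fld .fld) .fld
  | fmul : Circ (.prod .fld .fld) .fld
  | finv : Circ .fld .fld
  | feq : Circ (.prod .fld .fld) .bit
  | fbit (i : ℕ) : Circ .fld .bit
  | fofbit : Circ .bit .fld
  | ggen (a : Ty) : Circ a .grp
  | gmul : Circ (.prod .grp .grp) .grp
  | gpow : Circ (.prod .grp .fld) .grp
  | geq : Circ (.prod .grp .grp) .bit
  | gbit (i : ℕ) : Circ .grp .bit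
  | gdec (m : ℕ) : Circ (.pow .bit m) .grp
  | gdescr (a : Ty) (i : ℕ) : Circ a .bit

/-- The function that a circuit computes. -/
noncomputable def Circ.eval {q : ℕ} (P : PrimeGroup q) :
    {a b : Ty} → Circ a b → a.El P → b.El P
  | _, _, .id _, u => u
  | _, _, .comp f g, u => g.eval P (f.eval P u)
  | _, _, .pair f g, u => (f.eval P u, g.eval P u)
  | _, _, .fst _ _, u => u.1
  | _, _, .snd _ _, u => u.2
  | _, _, .tup f, u => fun i => (f i).eval P u
  | _, _, .proj _ i, u => u i
  | _, _, .bconst _ c, _ => c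
  | _, _, .band, u => u.1 && u.2
  | _, _, .bnot, u => !u
  | _, _, .fconst _ c, _ => (c : ZMod q)
  | _, _, .fadd, u => u.1 + u.2
  | _, _, .fmul, u => u.1 * u.2
  | _, _, .finv, u => Inv.inv (α := ZMod q) u
  | _, _, .feq, u => decide (u.1 = u.2)
  | _, _, .fbit i, u => Nat.testBit (ZMod.val (n := q) u) i
  | _, _, .fofbit, u => if u = true then 1 else 0
  | _, _, .ggen _, _ => P.gen
  | _, _, .gmul, u => u.1 * u.2
  | _, _, .gpow, u => u.1 ^ ZMod.val (n := q) u.2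
  | _, _, .geq, u => open Classical in decide (u.1 = u.2)
  | _, _, .gbit i, u => Nat.testBit (P.enc u) i
  | _, _, .gdec m, u => P.dec (Nat.ofBits (n := m) u)
  | _, _, .gdescr _ i, _ => P.descr.getD i false

/-- The number of gates of a circuit (tupling and wiring count too; decoding a group element
from `m` bits counts `m + 1`). -/
def Circ.size : {a b : Ty} → Circ a b → ℕ
  | _, _, .comp f g => f.size + g.size
  | _, _, .pair f g => f.size + g.size + 1
  | _, _, .tup f => (∑ i, (f i).size) + 1
  | _, _, .gdec m => m + 1
  | _, _, _ => 1

/-- A random tape: `m` uniform bits and `m` uniform elements of `ℤ_q`. -/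
@[reducible] def Ty.tape (m : ℕ) : Ty := .prod (.pow .bit m) (.pow .fld m)

/-! ### Pedersen commitments, public parameters, discrete logarithms -/

section Pedersen

variable {q : ℕ} (P : PrimeGroup q) (h : P.carrier)

/-- The Pedersen commitment to `m` with randomness `r`. -/
def com (m r : ZMod q) : P.carrier := P.gen ^ m.val * h ^ r.val

/-- The ideal functionality for bit proofs: the verifier submits the commitment `c`, the other
party the opening `(v, s)`. -/
noncomputable def orOracle (c : P.carrier) (v s : ZMod q) : Bool :=
  open Classical in decide ((v = 0 ∨ v = 1) ∧ c = com P h v s)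

end Pedersen

/-- Public parameters: the seed of the group, and the exponent `x ≠ 0` for which `h = g ^ x`.
No party is ever given `x`. -/
abbrev GroupGen.PP (S : GroupGen) (κ : ℕ) : Type := S.Seed κ × (ZMod (S.q κ))ˣ

/-- `Setup`: a sampled group with generator `g`, and an independent uniform generator `h`. -/
noncomputable def GroupGen.setup (S : GroupGen) (κ : ℕ) : PMF (S.PP κ) :=
  (S.law κ).bind fun ω => (PMF.uniformOfFintype (ZMod (S.q κ))ˣ).map fun x => (ω, x)

/-- The group that belongs to the public parameters. -/
abbrev GroupGen.gp (S : GroupGen) {κ : ℕ} (pp : S.PP κ) : PrimeGroup (S.q κ) := S.grp κ pp.1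

/-- The second generator of the public parameters. -/
def GroupGen.h (S : GroupGen) {κ : ℕ} (pp : S.PP κ) : (S.gp pp).carrier :=
  (S.gp pp).gen ^ (pp.2 : ZMod (S.q κ)).val

/-- A (non-uniform, probabilistic) polynomial time adversary in the discrete logarithm game. -/
structure DLAdversary where
  coins : ℕ → ℕ
  solve : ∀ κ, Circ (.prod (.tape (coins κ)) .grp) .fld
  coins_poly : PolyBounded coins
  solve_poly : PolyBounded fun κ => (solve κ).size

/-- The discrete logarithm game: `x` is uniform in `ℤ_q`, the adversary is given `g ^ x`. -/
noncomputable def dlGame (S : GroupGen) (B : DLAdversary) (κ : ℕ) : PMF Bool :=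
  (S.law κ).bind fun ω =>
    (PMF.uniformOfFintype (ZMod (S.q κ) ×
      ((Fin (B.coins κ) → Bool) × (Fin (B.coins κ) → ZMod (S.q κ))))).map fun w =>
        decide ((B.solve κ).eval (S.grp κ ω) (w.2, (S.grp κ ω).gen ^ w.1.val) = w.1)

/-- The advantage in the discrete logarithm game. -/
noncomputable def dlAdv (S : GroupGen) (B : DLAdversary) (κ : ℕ) : ENNReal :=
  dlGame S B κ true

/-- The discrete logarithm assumption. -/
def DLHard (S : GroupGen) : Prop :=
  ∀ B : DLAdversary, Negligible fun κ => (dlAdv S B κ).toReal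

/-! ### Computational indistinguishability -/

/-- A distinguisher for values of type `τ κ`. -/
structure Distinguisher (τ : ℕ → Ty) where
  coins : ℕ → ℕ
  guess : ∀ κ, Circ (.prod (.tape (coins κ)) (τ κ)) .bit
  coins_poly : PolyBounded coins
  guess_poly : PolyBounded fun κ => (guess κ).size

/-- The output of a distinguisher on a value drawn from `U`, for public parameters that are
drawn by `Setup`. -/
noncomputable def distGame (S : GroupGen) {τ : ℕ → Ty} (E : Distinguisher τ) (κ : ℕ)
    (U : ∀ pp : S.PP κ, PMF ((τ κ).El (S.gp pp))) : PMF Bool :=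
  (S.setup κ).bind fun pp => (U pp).bind fun u =>
    (PMF.uniformOfFintype
      ((Fin (E.coins κ) → Bool) × (Fin (E.coins κ) → ZMod (S.q κ)))).map fun t =>
        (E.guess κ).eval (S.gp pp) (t, u)

/-- Computational indistinguishability of two ensembles. -/
def CompIndist (S : GroupGen) (τ : ℕ → Ty)
    (U V : ∀ κ, ∀ pp : S.PP κ, PMF ((τ κ).El (S.gp pp))) : Prop :=
  ∀ E : Distinguisher τ, Negligible fun κ =>
    |(distGame S E κ (U κ) true).toReal - (distGame S E κ (V κ) true).toReal|

/-! ### The ideal functionality -/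

/-- The binomial distribution with parameters `n` and `1/2`. -/
noncomputable def binomialHalf (n : ℕ) : PMF (Fin (n + 1)) :=
  PMF.ofFintype (fun i => (n.choose i : ENNReal) / 2 ^ n) (by
    have h : ∑ i : Fin (n + 1), (n.choose i : ENNReal) = 2 ^ n := by
      rw [Fin.sum_univ_eq_sum_range (fun i => (n.choose i : ENNReal)) (n + 1)]
      exact_mod_cast Nat.sum_range_choose n
    simp only [div_eq_mul_inv]
    rw [← Finset.sum_mul, h]
    exact ENNReal.mul_inv_cancel (by simp) (by simp))

/-- `K` independent samples of the binomial distribution with parameters `nb` and `1/2`. -/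
noncomputable def noise (nb : ℕ) : (K : ℕ) → PMF (Fin K → ℕ)
  | 0 => PMF.pure Fin.elim0
  | K + 1 => (binomialHalf nb).bind fun a => (noise nb K).map fun f =>
      Fin.cons (α := fun _ => ℕ) (a : ℕ) f

/-- The functionality `M_Bin` on the provers' inputs `X`: the public output `y` and the noise
values that are handed to the provers. -/
noncomputable def mBin {q : ℕ} (nb : ℕ) {K : ℕ} (X : Fin K → ZMod q) :
    PMF (ZMod q × (Fin K → ZMod q)) :=
  (noise nb K).map fun Δ => (∑ k, (X k + (Δ k : ZMod q)), fun k => (Δ k : ZMod q))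

/-! ### The protocol -/

section Protocol

variable {q : ℕ} (P : PrimeGroup q) (h : P.carrier) {n nb K : ℕ}

/-- A bit as an element of `ℤ_q`. -/
def bitVal (v : Bool) : ZMod q := if v then 1 else 0

/-- The clients whose inputs are bits. -/
def legal (x : Fin n → ZMod q) : Finset (Fin n) :=
  Finset.univ.filter fun i => x i = 0 ∨ x i = 1

/-- The commitments to the shares, published by the clients (`sh k i` is the share of client `i`
for prover `k`, and `r k i` the randomness of the commitment). -/
def clientCom (sh r : Fin K → Fin n → ZMod q) (k : Fin K) (i : Fin n) : P.carrier :=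
  com P h (sh k i) (r k i)

/-- The public outcome of the validation of client `i`: the bit proof oracle is applied to the
derived commitment and to the opening that the client provides. -/
noncomputable def valid (x : Fin n → ZMod q) (sh r : Fin K → Fin n → ZMod q) (i : Fin n) : Bool :=
  orOracle P h (∏ k, clientCom P h sh r k i) (x i) (∑ k, r k i)

/-- The final message `(y_k, z_k)` of an honest prover, with validated clients `va`, shares `sh`,
their randomness `r`, private bits `v`, their randomness `s` and public bits `b`. -/
def response (va : Fin n → Bool) (sh r : Fin n → ZMod q) (v : Fin nb → Bool)
    (s : Fin nb → ZMod q) (b : Fin nb → Bool) : ZMod q × ZMod q :=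
  (∑ i with va i = true, sh i + ∑ j, (if b j then 1 - bitVal (v j) else bitVal (v j)),
    ∑ i with va i = true, r i + ∑ j, (if b j then - s j else s j))

/-- The verifier's final check of the message `yz` of one prover, with the client commitments `c`
and the commitments `c'` to the private bits of this prover. -/
noncomputable def check (va : Fin n → Bool) (c : Fin n → P.carrier) (c' : Fin nb → P.carrier)
    (b : Fin nb → Bool) (yz : ZMod q × ZMod q) : Bool :=
  open Classical in decide
    ((∏ i with va i = true, c i) * (∏ j, (if b j then com P h 1 0 * (c' j)⁻¹ else c' j)) =
      com P h yz.1 yz.2)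

/-- The randomness of the clients (`r`), of the honest provers (`v` and `s`), and of the public
coin oracle (`b`). -/
abbrev PartyRand (q n nb K : ℕ) : Type :=
  (Fin K → Fin n → ZMod q) × (Fin K → Fin nb → Bool) × (Fin K → Fin nb → ZMod q) ×
    (Fin K → Fin nb → Bool)

/-- What the verifier decides, and the published noisy count. -/
structure Outcome (q : ℕ) where
  accept : Bool
  y : ZMod q

/-- The execution of the protocol by honest parties. -/
noncomputable def honestOutcome (x : Fin n → ZMod q) (sh : Fin K → Fin n → ZMod q)
    (w : PartyRand q n nb K) : Outcome q :=
  let r := w.1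
  let v := w.2.1
  let s := w.2.2.1
  let b := w.2.2.2
  let va := valid P h x sh r
  let c' := fun k j => com P h (bitVal (v k j)) (s k j)
  let resp := fun k => response va (sh k) (r k) (v k) (s k) (b k)
  { accept :=
      decide (∀ k j, orOracle P h (c' k j) (bitVal (v k j)) (s k j) = true) &&
      decide (∀ k, check P h va (clientCom P h sh r k) (c' k) (b k) (resp k) = true)
    y := ∑ k, (resp k).1 }

/-! ### Corrupted parties -/

/-- The type of what the adversary sees at first: its coins, its auxiliary input, `h`, the shares
and commitment randomness of the corrupted provers, the client commitments, and which clients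
are valid. -/
@[reducible] def Ty.start (n K m l : ℕ) : Ty :=
  .prod (.tape m) (.prod (.pow .bit l) (.prod .grp
    (.prod (.pow (.pow (.prod .fld .fld) n) K)
      (.prod (.pow (.pow .grp n) K) (.pow .bit n)))))

/-- The initial view. Entries for provers outside of `I` are blanked. -/
noncomputable def startView {m l : ℕ} (I : Finset (Fin K)) (aux : Fin l → Bool)
    (x : Fin n → ZMod q) (sh r : Fin K → Fin n → ZMod q)
    (ρ : (Fin m → Bool) × (Fin m → ZMod q)) : (Ty.start n K m l).El P :=
  (ρ, aux, h, fun k i => if k ∈ I then (sh k i, r k i) else (0, 0),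
    clientCom P h sh r, valid P h x sh r)

/-- The commitments of the honest provers to their private bits; blanked for `k ∈ I`. -/
def honestComs (I : Finset (Fin K)) (v : Fin K → Fin nb → Bool) (s : Fin K → Fin nb → ZMod q)
    (k : Fin K) (j : Fin nb) : P.carrier :=
  if k ∈ I then 1 else com P h (bitVal (v k j)) (s k j)

/-- An adversary that controls provers, for one value of the security parameter. It sees
the messages of the honest provers in each round before it chooses those of the corrupted
provers. First come the commitments to private bits, with the openings for the bit
proof oracle; then, given the public coins, the final messages. -/
structure ProverAttack (n nb K m l : ℕ) where
  commit : Circ (.prod (.start n K m l) (.pow (.pow .grp nb) K))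
    (.pow (.pow (.prod .grp (.prod .fld .fld)) nb) K)
  respond : Circ (.prod (.prod (.start n K m l) (.pow (.pow .grp nb) K))
      (.prod (.pow (.pow .bit nb) K) (.pow (.prod .fld .fld) K)))
    (.pow (.prod .fld .fld) K)

/-- The outcome of an execution with corrupted provers and an honest verifier. -/
structure AttackOutcome (q : ℕ) where
  /-- the verifier did not abort before the public coins were tossed -/
  started : Bool
  /-- the decision of the verifier -/
  accept : Bool
  /-- the published value -/
  y : ZMod q
  /-- the correct value: the count of the clients' actual inputs, plus, for every prover, the sum
  of the exclusive ors of its committed bits with its public coins -/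
  ideal : ZMod q

/-- Execution with the provers in `I` corrupted. -/
noncomputable def attackOutcome {m l : ℕ} (A : ProverAttack n nb K m l) (I : Finset (Fin K))
    (aux : Fin l → Bool) (x : Fin n → ZMod q) (sh : Fin K → Fin n → ZMod q)
    (w : ((Fin m → Bool) × (Fin m → ZMod q)) × PartyRand q n nb K) : AttackOutcome q :=
  let r := w.2.1
  let v := w.2.2.1
  let s := w.2.2.2.1
  let b := w.2.2.2.2
  let va := valid P h x sh r
  let view := (startView P h I aux x sh r w.1, honestComs P h I v s)
  let a := A.commit.eval P view
  let c' := fun k j => if k ∈ I then (a k j).1 else com P h (bitVal (v k j)) (s k j)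
  let op := fun k j => if k ∈ I then (a k j).2 else (bitVal (v k j), s k j)
  let hresp := fun k => response va (sh k) (r k) (v k) (s k) (b k)
  let aresp := A.respond.eval P (view, b, fun k => if k ∈ I then (0, 0) else hresp k)
  let resp := fun k => if k ∈ I then aresp k else hresp k
  let started := decide (∀ k j, orOracle P h (c' k j) (op k j).1 (op k j).2 = true)
  { started := started
    accept := started &&
      decide (∀ k, check P h va (clientCom P h sh r k) (c' k) (b k) (resp k) = true)
    y := ∑ k, (resp k).1
    ideal := ∑ i ∈ legal x, x i +
      ∑ k, ∑ j, bitVal (xor (decide ((op k j).1 = 1)) (b k j)) }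

/-- A corrupted verifier that colludes with corrupted provers, for one value of the security
parameter. For every honest prover it chooses the commitments that it submits to the bit proof
oracle; given the answers, it chooses the honest provers with which it goes on to the public coin
oracle. -/
structure VerifierAttack (n nb K m l : ℕ) where
  submit : Circ (.prod (.start n K m l) (.pow (.pow .grp nb) K)) (.pow (.pow .grp nb) K)
  proceed : Circ (.prod (.prod (.start n K m l) (.pow (.pow .grp nb) K)) (.pow (.pow .bit nb) K))
    (.pow .bit K)

/-- The type of what is received after the start: the honest commitments, the answers of the
bit proof oracle, the public coins, and the final messages of the honest provers. -/
@[reducible] def Ty.received (nb K : ℕ) : Ty :=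
  .prod (.pow (.pow .grp nb) K) (.prod (.pow (.pow .bit nb) K)
    (.prod (.pow (.pow .bit nb) K) (.pow (.prod .fld .fld) K)))

/-- The type of a full view together with the noise values of the honest provers. -/
@[reducible] def Ty.joint (n nb K m l : ℕ) : Ty :=
  .prod (.prod (.start n K m l) (.received nb K)) (.pow .fld K)

/-- The view of a corrupted verifier and corrupted provers, jointly with the noise values of the
honest provers. Entries that the adversary does not receive are blanked. -/
noncomputable def realJoint {m l : ℕ} (A : VerifierAttack n nb K m l) (I : Finset (Fin K))
    (aux : Fin l → Bool) (x : Fin n → ZMod q) (sh : Fin K → Fin n → ZMod q)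
    (w : ((Fin m → Bool) × (Fin m → ZMod q)) × PartyRand q n nb K) : (Ty.joint n nb K m l).El P :=
  let r := w.2.1
  let v := w.2.2.1
  let s := w.2.2.2.1
  let b := w.2.2.2.2
  let va := valid P h x sh r
  let start := startView P h I aux x sh r w.1
  let c' := honestComs P h I v s
  let st := A.submit.eval P (start, c')
  let ans := fun k j =>
    if k ∈ I then false else orOracle P h (st k j) (bitVal (v k j)) (s k j)
  let go := A.proceed.eval P ((start, c'), ans)
  let coins := fun k j => if k ∈ I ∨ go k = true then b k j else false
  let resp := fun k => if k ∉ I ∧ go k = true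
    then response va (sh k) (r k) (v k) (s k) (b k) else (0, 0)
  ((start, c', ans, coins, resp),
    fun k => if k ∈ I then 0 else ∑ j, bitVal (xor (v k j) (b k j)))

/-- A simulator for one value of the security parameter, with `m'` coins. From the initial view it
computes the inputs of the corrupted provers to `M_Bin`; given `y` and the noise values of the
corrupted provers, it produces what is received after the start. -/
structure Simulation (n nb K m l m' : ℕ) where
  input : Circ (.prod (.tape m') (.start n K m l)) (.pow .fld K)
  output : Circ (.prod (.prod (.tape m') (.start n K m l)) (.prod .fld (.pow .fld K)))
    (.received nb K)

/-- The ideal counterpart of `realJoint`. The simulator is given the initial view, and of the output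
of `M_Bin` only `y` and the noise values of the corrupted provers. -/
noncomputable def idealJoint [NeZero q] {m l m' : ℕ} (Sim : Simulation n nb K m l m')
    (I : Finset (Fin K)) (aux : Fin l → Bool) (x : Fin n → ZMod q) (sh : Fin K → Fin n → ZMod q)
    (w : ((Fin m → Bool) × (Fin m → ZMod q)) × ((Fin m' → Bool) × (Fin m' → ZMod q)) ×
      (Fin K → Fin n → ZMod q)) : PMF ((Ty.joint n nb K m l).El P) :=
  let start := startView P h I aux x sh w.2.2 w.1
  let X := Sim.input.eval P (w.2.1, start)
  (mBin nb fun k => if k ∈ I then X k else ∑ i ∈ legal x, sh k i).map fun out =>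
    ((start, Sim.output.eval P ((w.2.1, start), out.1, fun k => if k ∈ I then out.2 k else 0)),
      fun k => if k ∈ I then 0 else out.2 k)

/-- Additive secret sharing: all shares but that of the first prover are the uniform values `t`. -/
def additiveShares (x : Fin n → ZMod q) (t : Fin K → Fin n → ZMod q) (k : Fin K) (i : Fin n) :
    ZMod q :=
  if k.val = 0 then x i - ∑ k' : Fin K with k'.val ≠ 0, t k' i else t k i

end Protocol

/-! ### Experiments, as functions of the security parameter -/

/-- Numbers of clients, of private bits per prover, and of provers. -/
structure Sizes where
  n : ℕ → ℕ
  nb : ℕ → ℕ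
  K : ℕ → ℕ
  n_poly : PolyBounded n
  nb_poly : PolyBounded nb
  K_poly : PolyBounded K
  nb_pos : ∀ κ, 1 ≤ nb κ
  K_pos : ∀ κ, 1 ≤ K κ

/-- A polynomial time adversary that controls provers. -/
structure ProverAdversary (N : Sizes) where
  coins : ℕ → ℕ
  auxLen : ℕ → ℕ
  alg : ∀ κ, ProverAttack (N.n κ) (N.nb κ) (N.K κ) (coins κ) (auxLen κ)
  coins_poly : PolyBounded coins
  auxLen_poly : PolyBounded auxLen
  commit_poly : PolyBounded fun κ => (alg κ).commit.size
  respond_poly : PolyBounded fun κ => (alg κ).respond.size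

/-- A polynomial time adversary that controls the verifier and provers. -/
structure VerifierAdversary (N : Sizes) where
  coins : ℕ → ℕ
  auxLen : ℕ → ℕ
  alg : ∀ κ, VerifierAttack (N.n κ) (N.nb κ) (N.K κ) (coins κ) (auxLen κ)
  coins_poly : PolyBounded coins
  auxLen_poly : PolyBounded auxLen
  submit_poly : PolyBounded fun κ => (alg κ).submit.size
  proceed_poly : PolyBounded fun κ => (alg κ).proceed.size

/-- A polynomial time simulator for the adversary `A`. -/
structure Simulator {N : Sizes} (A : VerifierAdversary N) where
  coins : ℕ → ℕ
  alg : ∀ κ, Simulation (N.n κ) (N.nb κ) (N.K κ) (A.coins κ) (A.auxLen κ) (coins κ)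
  coins_poly : PolyBounded coins
  input_poly : PolyBounded fun κ => (alg κ).input.size
  output_poly : PolyBounded fun κ => (alg κ).output.size

/-- The honest execution, with `Setup`. -/
noncomputable def honestExp (S : GroupGen) (N : Sizes) (κ : ℕ) (x : Fin (N.n κ) → ZMod (S.q κ))
    (sh : Fin (N.K κ) → Fin (N.n κ) → ZMod (S.q κ)) : PMF (Outcome (S.q κ)) :=
  (S.setup κ).bind fun pp =>
    (PMF.uniformOfFintype (PartyRand (S.q κ) (N.n κ) (N.nb κ) (N.K κ))).map fun w =>
      honestOutcome (S.gp pp) (S.h pp) x sh w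

/-- The execution with corrupted provers, with `Setup`. -/
noncomputable def attackExp (S : GroupGen) {N : Sizes} (A : ProverAdversary N) (κ : ℕ)
    (I : Finset (Fin (N.K κ))) (aux : Fin (A.auxLen κ) → Bool) (x : Fin (N.n κ) → ZMod (S.q κ))
    (sh : Fin (N.K κ) → Fin (N.n κ) → ZMod (S.q κ)) : PMF (AttackOutcome (S.q κ)) :=
  (S.setup κ).bind fun pp =>
    (PMF.uniformOfFintype (((Fin (A.coins κ) → Bool) × (Fin (A.coins κ) → ZMod (S.q κ))) ×
      PartyRand (S.q κ) (N.n κ) (N.nb κ) (N.K κ))).map fun w =>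
        attackOutcome (S.gp pp) (S.h pp) (A.alg κ) I aux x sh w

/-- The probability that the verifier accepts although the published value is wrong. -/
noncomputable def cheatProb (S : GroupGen) {N : Sizes} (A : ProverAdversary N) (κ : ℕ)
    (I : Finset (Fin (N.K κ))) (aux : Fin (A.auxLen κ) → Bool) (x : Fin (N.n κ) → ZMod (S.q κ))
    (sh : Fin (N.K κ) → Fin (N.n κ) → ZMod (S.q κ)) : ENNReal :=
  (attackExp S A κ I aux x sh).map (fun o => o.accept && decide (o.y ≠ o.ideal)) true

/-- The real view, jointly with the noise of the honest provers, for given public parameters;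
the clients' shares are random. -/
noncomputable def realEnsemble (S : GroupGen) {N : Sizes} (A : VerifierAdversary N) (κ : ℕ)
    (I : Finset (Fin (N.K κ))) (aux : Fin (A.auxLen κ) → Bool) (x : Fin (N.n κ) → ZMod (S.q κ))
    (pp : S.PP κ) :
    PMF ((Ty.joint (N.n κ) (N.nb κ) (N.K κ) (A.coins κ) (A.auxLen κ)).El (S.gp pp)) :=
  (PMF.uniformOfFintype (Fin (N.K κ) → Fin (N.n κ) → ZMod (S.q κ))).bind fun t =>
    (PMF.uniformOfFintype (((Fin (A.coins κ) → Bool) × (Fin (A.coins κ) → ZMod (S.q κ))) ×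
      PartyRand (S.q κ) (N.n κ) (N.nb κ) (N.K κ))).map fun w =>
        realJoint (S.gp pp) (S.h pp) (A.alg κ) I aux x (additiveShares x t) w

/-- The simulated view, jointly with the noise that `M_Bin` hands to the honest provers. -/
noncomputable def idealEnsemble (S : GroupGen) {N : Sizes} (A : VerifierAdversary N)
    (Sim : Simulator A) (κ : ℕ) (I : Finset (Fin (N.K κ))) (aux : Fin (A.auxLen κ) → Bool)
    (x : Fin (N.n κ) → ZMod (S.q κ)) (pp : S.PP κ) :
    PMF ((Ty.joint (N.n κ) (N.nb κ) (N.K κ) (A.coins κ) (A.auxLen κ)).El (S.gp pp)) :=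
  (PMF.uniformOfFintype (Fin (N.K κ) → Fin (N.n κ) → ZMod (S.q κ))).bind fun t =>
    (PMF.uniformOfFintype (((Fin (A.coins κ) → Bool) × (Fin (A.coins κ) → ZMod (S.q κ))) ×
      ((Fin (Sim.coins κ) → Bool) × (Fin (Sim.coins κ) → ZMod (S.q κ))) ×
        (Fin (N.K κ) → Fin (N.n κ) → ZMod (S.q κ)))).bind fun w =>
          idealJoint (S.gp pp) (S.h pp) (Sim.alg κ) I aux x (additiveShares x t) w

/-! Write h = g^a with a ≠ 0. In a group of prime order q the map `PrimeGroup.exp` is an injective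
homomorphism from ℤ_q, and Com(m, r) is the image of m + a·r. Oracle answers and final checks thus
become linear equations over ℤ_q. The exact equalities of distributions are changes of variables on
finite uniform spaces (`uniform_map_congr_of_injective`), once `mBin_eq` has written binomial noise
as a count of uniform bits.

Completeness: the flip sends an opening (v, s) to (1 - v, -s), compatibly with commitments
(`response_linear`), and v ⊕ b is uniform.

Soundness: the opened bits are fixed before the public coins, which act on them as a one-time pad;
hence the law of y* and its independence of an early abort (`attack_ideal_independent`). If the
verifier accepts a wrong y, some corrupted prover has answered with y_k different from the value Y_k
that its opened bits determine. Then (y_k, z_k) and (Y_k, Z_k) open the same commitment, and a =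
(y_k - Y_k)/(Z_k - z_k) (`extracted_of_cheat`). The reduction takes its challenge as h, plays
clients, honest provers and oracles itself, and tests the quotient of each corrupted prover against
h. The challenge may be 1, whereas h is a generator. The reduction answers 0 by default, so it
always wins in that case, and the bound holds without loss (`uniform_units_le`).

Zero-knowledge: the simulation is perfect. The simulator draws the messages Y_k of the honest
provers uniformly subject to the sum dictated by y, and programs the commitments so that the final
checks hold. Since a ≠ 0, commitments hide perfectly: an explicit injective map of the randomness
(`realRand`) turns the real experiment into the simulated one, noise included. It moves the honest
shares of one legal client by amounts of total 0 and compensates in the commitment randomness, so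
nothing visible changes (`realJoint_realRand`, `realRand_injective`). With a single honest prover no
share has to move, and no legal client is needed. -/

/-! ### Uniform distributions -/

section Uniform

variable {α β γ δ : Type} [Fintype α] [Fintype β] [Fintype γ] [Fintype δ] [Nonempty α]
  [Nonempty β] [Nonempty γ] [Nonempty δ]

/-- The map `f` sends the uniform distribution to the uniform distribution. -/
def PreservesUniform (f : α → β) : Prop :=
  (PMF.uniformOfFintype α).map f = PMF.uniformOfFintype β

/-- Merges the successive draws of an experiment into one uniform draw, on which a bijection of the
whole randomness can act. -/
theorem uniform_map_prod {ε : Type} (f : α × β → ε) :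
    (PMF.uniformOfFintype (α × β)).map f =
      (PMF.uniformOfFintype α).bind fun a => (PMF.uniformOfFintype β).map fun b => f (a, b) := by
  have h : PMF.uniformOfFintype (α × β) =
      (PMF.uniformOfFintype α).bind fun a => (PMF.uniformOfFintype β).map fun b => (a, b) := by
    ext ⟨a, b⟩
    rw [PMF.bind_apply, tsum_eq_single a, PMF.map_apply, tsum_eq_single b]
    · simp only [PMF.uniformOfFintype_apply, if_true, Fintype.card_prod, Nat.cast_mul]
      rw [ENNReal.mul_inv] <;> simp
    · intro b' hb
      simp [hb.symm]
    · intro a' ha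
      have : (PMF.map (fun b => (a', b)) (PMF.uniformOfFintype β)) (a, b) = 0 := by
        rw [PMF.map_apply, ENNReal.tsum_eq_zero]
        intro b'
        simp [ha.symm]
      rw [this, mul_zero]
  rw [h, PMF.map_bind]
  simp only [PMF.map_comp, Function.comp_def]

theorem preservesUniform_of_bijective {f : α → β} (hf : Function.Bijective f) : PreservesUniform f := by
  ext b
  obtain ⟨a, rfl⟩ := hf.2 b
  rw [PMF.map_apply, tsum_eq_single a]
  · simp [Fintype.card_of_bijective hf]
  · intro a' ha
    simp [hf.1.ne ha.symm]

theorem preservesUniform_equiv (e : α ≃ β) : PreservesUniform e := preservesUniform_of_bijective e.bijective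

theorem preservesUniform_fst : PreservesUniform (Prod.fst : α × β → α) := by
  rw [PreservesUniform, uniform_map_prod]
  have h : ∀ a : α, (PMF.uniformOfFintype β).map (fun _ => a) = PMF.pure a := fun a =>
    PMF.map_const _ a
  simp only [h]
  exact PMF.bind_pure _

theorem preservesUniform_snd : PreservesUniform (Prod.snd : α × β → β) := by
  rw [PreservesUniform, uniform_map_prod]
  exact (PMF.bind_const _ _).trans (PMF.map_id _)

theorem PreservesUniform.map_comp {ε : Type} {f : α → β} (hf : PreservesUniform f) (g : β → ε) :
    (PMF.uniformOfFintype α).map (fun a => g (f a)) = (PMF.uniformOfFintype β).map g := by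
  rw [← hf, PMF.map_comp]
  rfl

theorem PreservesUniform.comp {g : β → γ} {f : α → β} (hg : PreservesUniform g) (hf : PreservesUniform f) :
    PreservesUniform fun a => g (f a) :=
  (hf.map_comp g).trans hg

theorem PreservesUniform.prodMap {f : α → β} {g : γ → δ} (hf : PreservesUniform f) (hg : PreservesUniform g) :
    PreservesUniform fun u : α × γ => (f u.1, g u.2) := by
  rw [PreservesUniform, uniform_map_prod]
  have h1 : ∀ a, (PMF.uniformOfFintype γ).map (fun c => (f a, g c)) =
      (PMF.uniformOfFintype δ).map fun d => (f a, d) := fun a =>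
    hg.map_comp fun d => (f a, d)
  simp only [h1]
  have h2 := PMF.bind_map (PMF.uniformOfFintype α) f fun b =>
    (PMF.uniformOfFintype δ).map fun d => (b, d)
  rw [hf] at h2
  refine Eq.trans h2.symm ?_
  exact (uniform_map_prod fun u : β × δ => u).symm.trans (PMF.map_id _)

/-- Change of variables: on a finite type an injective self-map is bijective and preserves the
uniform law. Completeness, the law of y* and perfect simulation each come down to a choice of φ. -/
theorem uniform_map_congr_of_injective {ε : Type} {f g : α → ε} (φ : α → α) (hφ : Function.Injective φ)
    (h : ∀ a, f (φ a) = g a) :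
    (PMF.uniformOfFintype α).map f = (PMF.uniformOfFintype α).map g := by
  have hb : PreservesUniform φ := preservesUniform_of_bijective (Finite.injective_iff_bijective.mp hφ)
  rw [← hb.map_comp f]
  congr 1
  exact funext h

theorem uniform_map_apply_true (p : α → Bool) :
    (PMF.uniformOfFintype α).map p true =
      ((Finset.univ.filter fun a => p a = true).card : ENNReal) * (Fintype.card α : ENNReal)⁻¹ := by
  rw [PMF.map_apply, tsum_fintype]
  simp only [PMF.uniformOfFintype_apply, eq_comm (a := true)]
  rw [← Finset.sum_filter, Finset.sum_const, nsmul_eq_mul]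

end Uniform

/-! ### Binomial noise as a count of uniform bits -/

section Noise

/-- The number of `true` entries. -/
def countTrue {n : ℕ} (u : Fin n → Bool) : ℕ := ∑ j, if u j then 1 else 0

/-- Pascal's rule, by splitting off the first bit. -/
theorem card_countTrue (n i : ℕ) :
    (Finset.univ.filter fun u : Fin n → Bool => countTrue u = i).card = n.choose i := by
  induction n generalizing i with
  | zero =>
    cases i <;> simp [countTrue]
  | succ n ih =>
    have key : ∀ (b : Bool), (Finset.univ.filter fun u : Fin n → Bool =>
        countTrue (Fin.cons (α := fun _ => Bool) b u : Fin (n + 1) → Bool) = i).card =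
          (if b then (match i with | 0 => 0 | i + 1 => n.choose i) else n.choose i) := by
      intro b
      have hc : ∀ u : Fin n → Bool, countTrue (Fin.cons (α := fun _ => Bool) b u : Fin (n + 1) → Bool)
          = (if b then 1 else 0) + countTrue u := by
        intro u
        rw [countTrue, Fin.sum_univ_succ]
        simp only [Fin.cons_zero, Fin.cons_succ]
        rfl
      simp only [hc]
      cases b
      · simpa using ih i
      · cases i with
        | zero => simp
        | succ i =>
          simp only [if_true]
          rw [← ih i]
          congr 1
          ext u
          simp
          omega
    have hcard : (Finset.univ.filter fun u : Fin (n + 1) → Bool => countTrue u = i).card =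
        ∑ b : Bool, (Finset.univ.filter fun u : Fin n → Bool =>
          countTrue (Fin.cons (α := fun _ => Bool) b u : Fin (n + 1) → Bool) = i).card := by
      simp only [Finset.card_filter]
      rw [← (Fin.consEquiv fun _ : Fin (n + 1) => Bool).sum_comp, Fintype.sum_prod_type]
      rfl
    rw [hcard, Fintype.sum_bool, key, key]
    cases i with
    | zero => simp
    | succ i => simp [Nat.choose_succ_succ]

theorem binomialHalf_map_val (n : ℕ) :
    (binomialHalf n).map Fin.val =
      (PMF.uniformOfFintype (Fin n → Bool)).map countTrue := by
  ext i
  have hR : (PMF.uniformOfFintype (Fin n → Bool)).map countTrue i =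
      (n.choose i : ENNReal) * ((2 : ENNReal) ^ n)⁻¹ := by
    rw [PMF.map_apply, tsum_fintype]
    simp only [PMF.uniformOfFintype_apply, eq_comm (a := i)]
    rw [← Finset.sum_filter, Finset.sum_const, nsmul_eq_mul, card_countTrue]
    simp
  rw [hR, PMF.map_apply, tsum_fintype]
  by_cases hi : i < n + 1
  · rw [Finset.sum_eq_single (⟨i, hi⟩ : Fin (n + 1))]
    · simp [binomialHalf, div_eq_mul_inv]
    · intro b _ hb
      rw [if_neg]
      rintro rfl
      exact hb rfl
    · simp
  · rw [Finset.sum_eq_zero]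
    · rw [Nat.choose_eq_zero_of_lt (by omega)]
      simp
    · intro b _
      rw [if_neg]
      have := b.2
      omega

theorem noise_eq (nb K : ℕ) :
    noise nb K = (PMF.uniformOfFintype (Fin K → Fin nb → Bool)).map fun u k => countTrue (u k) := by
  induction K with
  | zero =>
    rw [noise]
    have : (fun (u : Fin 0 → Fin nb → Bool) (k : Fin 0) => countTrue (u k)) =
        Function.const _ Fin.elim0 := by
      funext u k
      exact k.elim0
    rw [this, PMF.map_const]
  | succ K ih =>
    have hb := preservesUniform_equiv (Fin.consEquiv fun _ : Fin (K + 1) => Fin nb → Bool)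
    rw [noise, ← hb.map_comp, uniform_map_prod, ih]
    have h2 := PMF.bind_map (binomialHalf nb) Fin.val fun a =>
      ((PMF.uniformOfFintype (Fin K → Fin nb → Bool)).map fun u k => countTrue (u k)).map fun f =>
        (Fin.cons (α := fun _ => ℕ) a f : Fin (K + 1) → ℕ)
    refine Eq.trans h2.symm ?_
    rw [binomialHalf_map_val, PMF.bind_map]
    congr 1
    funext a
    simp only [Function.comp, PMF.map_comp]
    congr 1
    funext u
    funext k
    refine Fin.cases ?_ (fun k => ?_) k <;> simp [Fin.consEquiv]

/-- Gives the noise the same shape as in the protocol, where it is the sum of the bits v ⊕ b, so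
that the two can be matched bit by bit. -/
theorem mBin_eq {q : ℕ} (nb : ℕ) {K : ℕ} (X : Fin K → ZMod q) :
    mBin nb X = (PMF.uniformOfFintype (Fin K → Fin nb → Bool)).map fun u =>
      (∑ k, (X k + ∑ j, bitVal (u k j)), fun k => ∑ j, bitVal (u k j)) := by
  have h : ∀ {n : ℕ} (u : Fin n → Bool), ((countTrue u : ℕ) : ZMod q) = ∑ j, bitVal (u j) := by
    intro n u
    simp [countTrue, bitVal]
  rw [mBin, noise_eq, PMF.map_comp]
  congr 1
  funext u
  simp [Function.comp, h]

end Noise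

/-! ### Exponents in groups of prime order -/

namespace PrimeGroup

theorem pow_order {q : ℕ} {P : PrimeGroup q} (x : P.carrier) : x ^ q = 1 := by
  have h := pow_card_eq_one' (x := x)
  rwa [P.card_eq] at h

variable {q : ℕ} [Fact q.Prime] (P : PrimeGroup q)

variable {P} in
-- Since x^q = 1, the choice of a representative of the exponent is irrelevant. The exponent laws
-- over ℤ_q follow from this.
theorem pow_natCast_val (x : P.carrier) (m : ℕ) : x ^ (m : ZMod q).val = x ^ m := by
  rw [ZMod.val_natCast]
  exact (pow_eq_pow_mod m (pow_order x)).symm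

variable {P} in
theorem pow_val_add (x : P.carrier) (a b : ZMod q) : x ^ (a + b).val = x ^ a.val * x ^ b.val := by
  rw [← pow_add, ← pow_natCast_val x (a.val + b.val)]
  simp

variable {P} in
theorem pow_val_mul (x : P.carrier) (a b : ZMod q) : x ^ (a * b).val = (x ^ a.val) ^ b.val := by
  rw [← pow_mul, ← pow_natCast_val x (a.val * b.val)]
  simp

variable {P} in
theorem pow_val_neg (x : P.carrier) (a : ZMod q) : x ^ (-a).val = (x ^ a.val)⁻¹ := by
  rw [eq_inv_iff_mul_eq_one, ← pow_val_add]
  simp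

/-- The power of the distinguished generator with exponent in `ℤ_q`. -/
def exp (z : ZMod q) : P.carrier := P.gen ^ z.val

theorem exp_zero : P.exp 0 = 1 := by simp [exp]

theorem exp_add (a b : ZMod q) : P.exp (a + b) = P.exp a * P.exp b := pow_val_add _ a b

theorem exp_neg (a : ZMod q) : P.exp (-a) = (P.exp a)⁻¹ := pow_val_neg _ a

theorem exp_sub (a b : ZMod q) : P.exp (a - b) = P.exp a * (P.exp b)⁻¹ := by
  rw [sub_eq_add_neg, exp_add, exp_neg]

theorem exp_mul (a b : ZMod q) : P.exp (a * b) = P.exp a ^ b.val := pow_val_mul _ a b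

theorem exp_sum {ι : Type*} (s : Finset ι) (f : ι → ZMod q) :
    P.exp (∑ i ∈ s, f i) = ∏ i ∈ s, P.exp (f i) := by
  classical
  induction s using Finset.induction_on with
  | empty => simp [exp_zero]
  | insert i s hi ih => rw [Finset.sum_insert hi, Finset.prod_insert hi, exp_add, ih]

theorem orderOf_gen {q : ℕ} (P : PrimeGroup q) : orderOf P.gen = q := by
  refine Eq.trans ?_ P.card_eq
  exact orderOf_eq_card_of_forall_mem_zpowers P.gen_generates

theorem exp_injective : Function.Injective P.exp := by
  intro a b hab
  apply ZMod.val_injective q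
  refine pow_injOn_Iio_orderOf ?_ ?_ hab <;> rw [Set.mem_Iio, orderOf_gen] <;> exact ZMod.val_lt _

theorem com_eq_exp (a m r : ZMod q) : com P (P.exp a) m r = P.exp (m + a * r) := by
  rw [com, exp_add, exp_mul]
  rfl

theorem orOracle_exp (a c v s : ZMod q) :
    orOracle P (P.exp a) (P.exp c) v s = decide ((v = 0 ∨ v = 1) ∧ c = v + a * s) := by
  rw [orOracle, com_eq_exp]
  simp only [P.exp_injective.eq_iff]

theorem clientCom_exp {n K : ℕ} (a : ZMod q) (sh r : Fin K → Fin n → ZMod q) (k : Fin K) (i : Fin n) :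
    clientCom P (P.exp a) sh r k i = P.exp (sh k i + a * r k i) :=
  com_eq_exp P a _ _

/-- The product of a client's commitments has exponent x_i + a·∑ r, which is the one its opening
claims; only the bit test remains. Validity therefore depends on the input alone, not on shares or
randomness. -/
theorem valid_eq {n K : ℕ} (a : ZMod q) (x : Fin n → ZMod q) (sh r : Fin K → Fin n → ZMod q)
    (hsh : ∀ i, ∑ k, sh k i = x i) (i : Fin n) :
    valid P (P.exp a) x sh r i = decide (x i = 0 ∨ x i = 1) := by
  simp only [valid, clientCom_exp]
  rw [← exp_sum, orOracle_exp, Finset.sum_add_distrib, hsh, Finset.mul_sum]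
  simp

theorem valid_filter {n K : ℕ} (a : ZMod q) (x : Fin n → ZMod q) (sh r : Fin K → Fin n → ZMod q)
    (hsh : ∀ i, ∑ k, sh k i = x i) :
    (Finset.univ.filter fun i => valid P (P.exp a) x sh r i = true) = legal x := by
  ext i
  simp [legal, valid_eq P a x sh r hsh]

theorem check_exp {n nb : ℕ} (a : ZMod q) (va : Fin n → Bool) (c : Fin n → ZMod q)
    (c' : Fin nb → ZMod q) (b : Fin nb → Bool) (yz : ZMod q × ZMod q) :
    check P (P.exp a) va (fun i => P.exp (c i)) (fun j => P.exp (c' j)) b yz =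
      decide (∑ i with va i = true, c i + ∑ j, (if b j then 1 - c' j else c' j) =
        yz.1 + a * yz.2) := by
  have h : ∀ j, (if b j then com P (P.exp a) 1 0 * (P.exp (c' j))⁻¹ else P.exp (c' j)) =
      P.exp (if b j then 1 - c' j else c' j) := by
    intro j
    split_ifs
    · rw [com_eq_exp, exp_sub, mul_zero, add_zero]
    · rfl
  rw [check, decide_eq_decide, P.com_eq_exp a yz.1, ← P.exp_injective.eq_iff,
    P.exp_add (Finset.sum _ _), exp_sum, exp_sum, ← Finset.prod_congr rfl fun j _ => h j]

end PrimeGroup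

/-! ### Linear identities for flipped bits and openings -/

section Algebra

variable {q : ℕ}

theorem bitVal_xor (v b : Bool) :
    (bitVal (xor v b) : ZMod q) = if b then 1 - bitVal v else bitVal v := by
  cases v <;> cases b <;> simp [bitVal]

theorem bitVal_eq (v : Bool) : (bitVal v : ZMod q) = 0 ∨ (bitVal v : ZMod q) = 1 := by
  cases v <;> simp [bitVal]

/-- On exponents c = v + a·s the flip is c ↦ 1 - c, on openings it is (v, s) ↦ (1 - v, -s), and
openings add. The values v are arbitrary elements of ℤ_q, so that the identity serves for honest
bits and for adversarial openings alike. -/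
theorem response_linear {n nb : ℕ} (a : ZMod q) (va : Fin n → Bool) (sh r : Fin n → ZMod q)
    (v s : Fin nb → ZMod q) (b : Fin nb → Bool) :
    ∑ i with va i = true, (sh i + a * r i) +
        ∑ j, (if b j then 1 - (v j + a * s j) else v j + a * s j) =
      (∑ i with va i = true, sh i + ∑ j, (if b j then 1 - v j else v j)) +
        a * (∑ i with va i = true, r i + ∑ j, (if b j then - s j else s j)) := by
  have h : ∀ j, (if b j then 1 - (v j + a * s j) else v j + a * s j) =
      (if b j then 1 - v j else v j) + a * (if b j then - s j else s j) := by
    intro j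
    split_ifs <;> ring
  simp only [h, Finset.sum_add_distrib, mul_add, Finset.mul_sum]
  ring

end Algebra

theorem GroupGen.h_eq_exp (S : GroupGen) {κ : ℕ} (pp : S.PP κ) :
    S.h pp = (S.gp pp).exp (pp.2 : ZMod (S.q κ)) := rfl

/-! ### Completeness -/

section Honest

variable {q : ℕ} [Fact q.Prime] (P : PrimeGroup q) {n nb K : ℕ}

theorem honestOutcome_eq (a : ZMod q) (x : Fin n → ZMod q) (sh : Fin K → Fin n → ZMod q)
    (hsh : ∀ i, ∑ k, sh k i = x i) (w : PartyRand q n nb K) :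
    honestOutcome P (P.exp a) x sh w =
      ⟨true, ∑ k, (∑ i ∈ legal x, sh k i + ∑ j, bitVal (xor (w.2.1 k j) (w.2.2.2 k j)))⟩ := by
  simp only [honestOutcome, P.com_eq_exp, P.orOracle_exp]
  congr 1
  · simp only [Bool.and_eq_true, decide_eq_true_eq]
    refine ⟨fun k j => ⟨bitVal_eq _, trivial⟩, fun k => ?_⟩
    have hc : clientCom P (P.exp a) sh w.1 k = fun i => P.exp (sh k i + a * w.1 k i) :=
      funext fun i => P.clientCom_exp a sh w.1 k i
    rw [hc, P.check_exp, decide_eq_true_eq]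
    exact response_linear a _ _ _ (fun j => bitVal (w.2.1 k j)) _ _
  · simp only [response, P.valid_filter a x sh w.1 hsh, bitVal_xor]

end Honest

theorem honest_completeness (S : GroupGen) (N : Sizes) (κ : ℕ) (x : Fin (N.n κ) → ZMod (S.q κ))
    (sh : Fin (N.K κ) → Fin (N.n κ) → ZMod (S.q κ)) (hsh : ∀ i, ∑ k, sh k i = x i) :
    (honestExp S N κ x sh).map (fun o => o.accept) false = 0 ∧
      (honestExp S N κ x sh).map (fun o => o.y) =
        (mBin (N.nb κ) fun k => ∑ i ∈ legal x, sh k i).map Prod.fst := by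
  constructor
  · rw [honestExp, PMF.map_bind]
    simp only [PMF.map_comp, Function.comp_def, S.h_eq_exp, honestOutcome_eq _ _ _ _ hsh]
    rw [PMF.bind_apply, ENNReal.tsum_eq_zero]
    intro pp
    rw [mul_eq_zero]
    right
    rw [PMF.map_apply, ENNReal.tsum_eq_zero]
    intro w
    simp
  · rw [honestExp, PMF.map_bind]
    simp only [PMF.map_comp, Function.comp_def, S.h_eq_exp, honestOutcome_eq _ _ _ _ hsh]
    rw [PMF.bind_const, mBin_eq, PMF.map_comp]
    have h1 : PreservesUniform fun w : PartyRand (S.q κ) (N.n κ) (N.nb κ) (N.K κ) => w.2.1 :=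
      preservesUniform_fst.comp preservesUniform_snd
    rw [Function.comp_def, ← h1.map_comp]
    -- Replacing v by v ⊕ b cancels the public coins and leaves the count of the bits v.
    refine uniform_map_congr_of_injective
      (fun w => (w.1, (fun k j => xor (w.2.1 k j) (w.2.2.2 k j)), w.2.2)) ?_ ?_
    · rintro ⟨r, v, s, b⟩ ⟨r', v', s', b'⟩ h
      simp only [Prod.mk.injEq] at h
      obtain ⟨rfl, hv, rfl, rfl⟩ := h
      have : v = v' := by
        funext k j
        simpa using congrFun (congrFun hv k) j
      rw [this]
    · intro w
      simp

/-! ### Executions with corrupted provers -/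

section Attack

variable {q : ℕ} (P : PrimeGroup q) (h : P.carrier) {n nb K m l : ℕ}
  (A : ProverAttack n nb K m l) (I : Finset (Fin K)) (aux : Fin l → Bool)
  (x : Fin n → ZMod q) (sh : Fin K → Fin n → ZMod q)

/-- The view of corrupted provers before they commit to their private bits. -/
noncomputable def attackView (w : ((Fin m → Bool) × (Fin m → ZMod q)) × PartyRand q n nb K) :
    (Ty.prod (.start n K m l) (.pow (.pow .grp nb) K)).El P :=
  (startView P h I aux x sh w.2.1 w.1, honestComs P h I w.2.2.1 w.2.2.2.1)

/-- The openings of the commitments to the private bits of all provers. -/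
noncomputable def attackOpening (w : ((Fin m → Bool) × (Fin m → ZMod q)) × PartyRand q n nb K)
    (k : Fin K) (j : Fin nb) : ZMod q × ZMod q :=
  if k ∈ I then (A.commit.eval P (attackView P h I aux x sh w) k j).2
  else (bitVal (w.2.2.1 k j), w.2.2.2.1 k j)

/-- The final message of an honest prover. -/
noncomputable def honestResponse (w : ((Fin m → Bool) × (Fin m → ZMod q)) × PartyRand q n nb K)
    (k : Fin K) : ZMod q × ZMod q :=
  response (valid P h x sh w.2.1) (sh k) (w.2.1 k) (w.2.2.1 k) (w.2.2.2.1 k) (w.2.2.2.2 k)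

/-- The final messages of all provers. -/
noncomputable def attackResponse (w : ((Fin m → Bool) × (Fin m → ZMod q)) × PartyRand q n nb K)
    (k : Fin K) : ZMod q × ZMod q :=
  if k ∈ I then A.respond.eval P (attackView P h I aux x sh w, w.2.2.2.2,
    fun k => if k ∈ I then (0, 0) else honestResponse P h x sh w k) k
  else honestResponse P h x sh w k

/-- The opening `(y, z)` of the final check that the openings of the individual commitments
determine. -/
noncomputable def expectedResponse (w : ((Fin m → Bool) × (Fin m → ZMod q)) × PartyRand q n nb K)
    (k : Fin K) : ZMod q × ZMod q :=
  (∑ i ∈ legal x, sh k i + ∑ j, (if w.2.2.2.2 k j then 1 - (attackOpening P h A I aux x sh w k j).1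
      else (attackOpening P h A I aux x sh w k j).1),
    ∑ i ∈ legal x, w.2.1 k i + ∑ j, (if w.2.2.2.2 k j then
      - (attackOpening P h A I aux x sh w k j).2 else (attackOpening P h A I aux x sh w k j).2))

/-- The discrete logarithm computed from two openings of one commitment. -/
noncomputable def extracted [Fact q.Prime]
    (w : ((Fin m → Bool) × (Fin m → ZMod q)) × PartyRand q n nb K) (k : Fin K) : ZMod q :=
  ((attackResponse P h A I aux x sh w k).1 - (expectedResponse P h A I aux x sh w k).1) *
    ((expectedResponse P h A I aux x sh w k).2 - (attackResponse P h A I aux x sh w k).2)⁻¹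

theorem attackOutcome_ideal (w : ((Fin m → Bool) × (Fin m → ZMod q)) × PartyRand q n nb K) :
    (attackOutcome P h A I aux x sh w).ideal = ∑ i ∈ legal x, x i +
      ∑ k, ∑ j, bitVal (xor (decide ((attackOpening P h A I aux x sh w k j).1 = 1))
        (w.2.2.2.2 k j)) := rfl

theorem attackOutcome_y (w : ((Fin m → Bool) × (Fin m → ZMod q)) × PartyRand q n nb K) :
    (attackOutcome P h A I aux x sh w).y = ∑ k, (attackResponse P h A I aux x sh w k).1 := rfl

variable [Fact q.Prime]

/-- Acceptance by the bit proof oracle pins the exponent of every commitment to that of its opening.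
The final check then equates two openings of one commitment: the expected one and the one sent. -/
theorem attackOutcome_accept (a : ZMod q) (hsh : ∀ i, ∑ k, sh k i = x i)
    (w : ((Fin m → Bool) × (Fin m → ZMod q)) × PartyRand q n nb K)
    (hacc : (attackOutcome P (P.exp a) A I aux x sh w).accept = true) :
    (∀ k j, (attackOpening P (P.exp a) A I aux x sh w k j).1 = 0 ∨
      (attackOpening P (P.exp a) A I aux x sh w k j).1 = 1) ∧
    ∀ k, (expectedResponse P (P.exp a) A I aux x sh w k).1 +
        a * (expectedResponse P (P.exp a) A I aux x sh w k).2 =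
      (attackResponse P (P.exp a) A I aux x sh w k).1 +
        a * (attackResponse P (P.exp a) A I aux x sh w k).2 := by
  set op := attackOpening P (P.exp a) A I aux x sh w
  obtain ⟨c', hst, hch⟩ : ∃ c' : Fin K → Fin nb → P.carrier,
      (∀ k j, orOracle P (P.exp a) (c' k j) (op k j).1 (op k j).2 = true) ∧
      ∀ k, check P (P.exp a) (valid P (P.exp a) x sh w.2.1)
        (clientCom P (P.exp a) sh w.2.1 k) (c' k) (w.2.2.2.2 k)
        (attackResponse P (P.exp a) A I aux x sh w k) = true := by
    refine ⟨fun k j => if k ∈ I then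
      (A.commit.eval P (attackView P (P.exp a) I aux x sh w) k j).1
      else com P (P.exp a) (bitVal (w.2.2.1 k j)) (w.2.2.2.1 k j), ?_⟩
    have h1 := (Bool.and_eq_true _ _).mp hacc
    exact ⟨of_decide_eq_true h1.1, of_decide_eq_true h1.2⟩
  have hc : ∀ k j, ((op k j).1 = 0 ∨ (op k j).1 = 1) ∧
      c' k j = P.exp ((op k j).1 + a * (op k j).2) := by
    intro k j
    have := hst k j
    simp only [orOracle, decide_eq_true_eq] at this
    rwa [P.com_eq_exp] at this
  refine ⟨fun k j => (hc k j).1, fun k => ?_⟩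
  have hk := hch k
  have e1 : clientCom P (P.exp a) sh w.2.1 k = fun i => P.exp (sh k i + a * w.2.1 k i) :=
    funext fun i => P.clientCom_exp a sh w.2.1 k i
  have e2 : c' k = fun j => P.exp ((op k j).1 + a * (op k j).2) := funext fun j => (hc k j).2
  rw [e1, e2, P.check_exp, decide_eq_true_eq, response_linear a _ _ _ (fun j => (op k j).1)
    (fun j => (op k j).2), P.valid_filter a x sh _ hsh] at hk
  exact hk

/-- The correct output is the sum of the expected first components, so a wrong sum has a wrong
summand. It cannot belong to an honest prover, and its two openings determine a. -/
theorem extracted_of_cheat (a : ZMod q) (hsh : ∀ i, ∑ k, sh k i = x i)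
    (w : ((Fin m → Bool) × (Fin m → ZMod q)) × PartyRand q n nb K)
    (hacc : (attackOutcome P (P.exp a) A I aux x sh w).accept = true)
    (hne : (attackOutcome P (P.exp a) A I aux x sh w).y ≠
      (attackOutcome P (P.exp a) A I aux x sh w).ideal) :
    ∃ k ∈ I, extracted P (P.exp a) A I aux x sh w k = a := by
  obtain ⟨hbit, hlin⟩ := attackOutcome_accept P A I aux x sh a hsh w hacc
  have hideal : (attackOutcome P (P.exp a) A I aux x sh w).ideal =
      ∑ k, (expectedResponse P (P.exp a) A I aux x sh w k).1 := by
    rw [attackOutcome_ideal]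
    simp only [expectedResponse, Finset.sum_add_distrib]
    congr 1
    · rw [Finset.sum_comm]
      exact Finset.sum_congr rfl fun i _ => (hsh i).symm
    · refine Finset.sum_congr rfl fun k _ => Finset.sum_congr rfl fun j _ => ?_
      rw [bitVal_xor]
      -- The oracle has accepted, so the opened value is 0 or 1, and reading values other than 1 as
      -- 0 loses nothing.
      have : (bitVal (decide ((attackOpening P (P.exp a) A I aux x sh w k j).1 = 1)) : ZMod q) =
          (attackOpening P (P.exp a) A I aux x sh w k j).1 := by
        rcases hbit k j with h0 | h0 <;> simp [h0, bitVal]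
      rw [this]
  rw [attackOutcome_y, hideal] at hne
  obtain ⟨k, hk⟩ : ∃ k, (attackResponse P (P.exp a) A I aux x sh w k).1 ≠
      (expectedResponse P (P.exp a) A I aux x sh w k).1 := by
    by_contra! hall
    exact hne (Finset.sum_congr rfl fun k _ => hall k)
  refine ⟨k, ?_, ?_⟩
  · by_contra hkI
    refine hk ?_
    simp only [attackResponse, expectedResponse, attackOpening, if_neg hkI, honestResponse, response,
      P.valid_filter a x sh _ hsh]
  · have hl := hlin k
    have h1 : a * ((expectedResponse P (P.exp a) A I aux x sh w k).2 -
        (attackResponse P (P.exp a) A I aux x sh w k).2) =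
        (attackResponse P (P.exp a) A I aux x sh w k).1 -
        (expectedResponse P (P.exp a) A I aux x sh w k).1 := by linear_combination hl
    rw [extracted, ← h1, mul_assoc, mul_inv_cancel₀, mul_one]
    -- With equal second components the linear relation would force equal first components, so the
    -- quotient is legitimate.
    intro h0
    rw [h0, mul_zero] at h1
    exact hk (sub_eq_zero.mp h1.symm)

/-- One-time pad: the opened bits and the decision to abort are functions of the randomness other
than b, so the exclusive or with b is uniform and independent of them. Only the sum of X enters the
public output. -/
theorem attack_ideal_independent (X : Fin K → ZMod q)
    (hX : ∑ i ∈ legal x, x i = ∑ k, X k) :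
    (PMF.uniformOfFintype (((Fin m → Bool) × (Fin m → ZMod q)) × PartyRand q n nb K)).map
        (fun w => ((attackOutcome P h A I aux x sh w).started,
          (attackOutcome P h A I aux x sh w).ideal)) =
      ((PMF.uniformOfFintype (((Fin m → Bool) × (Fin m → ZMod q)) × PartyRand q n nb K)).map
        fun w => (attackOutcome P h A I aux x sh w).started).bind fun st =>
          (mBin nb X).map fun out => (st, out.1) := by
  simp only [mBin_eq, PMF.map_comp, PMF.bind_map, Function.comp_def]
  rw [← uniform_map_prod fun u : (((Fin m → Bool) × (Fin m → ZMod q)) × PartyRand q n nb K) ×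
      (Fin K → Fin nb → Bool) => ((attackOutcome P h A I aux x sh u.1).started,
        ∑ k, (X k + ∑ j, bitVal (u.2 k j))),
    ← preservesUniform_fst (β := Fin K → Fin nb → Bool) |>.map_comp]
  -- The fresh bits u, masked by the opened bits, become the public coins, while the old coins take
  -- the place of u. This keeps the map injective, because the openings do not change.
  refine uniform_map_congr_of_injective (fun u => ((u.1.1, u.1.2.1, u.1.2.2.1, u.1.2.2.2.1,
    fun k j => xor (decide ((attackOpening P h A I aux x sh u.1 k j).1 = 1)) (u.2 k j)),
      u.1.2.2.2.2)) ?_ ?_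
  · rintro ⟨⟨ρ, r, v, s, b⟩, u⟩ ⟨⟨ρ', r', v', s', b'⟩, u'⟩ h
    simp only [Prod.mk.injEq] at h
    obtain ⟨⟨rfl, rfl, rfl, rfl, hu⟩, rfl⟩ := h
    have : u = u' := by
      funext k j
      simpa using congrFun (congrFun hu k) j
    rw [this]
  · rintro ⟨⟨ρ, r, v, s, b⟩, u⟩
    refine Prod.ext rfl ?_
    simp only [attackOutcome_ideal]
    rw [hX, Finset.sum_add_distrib]
    congr 1
    refine Finset.sum_congr rfl fun k _ => Finset.sum_congr rfl fun j _ => congrArg bitVal ?_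
    -- True by definition: the openings are chosen before the coins and do not mention them.
    have h1 : attackOpening P h A I aux x sh (ρ, r, v, s, fun k j =>
        xor (decide ((attackOpening P h A I aux x sh (ρ, r, v, s, b) k j).1 = 1)) (u k j)) =
        attackOpening P h A I aux x sh (ρ, r, v, s, b) := rfl
    rw [h1]
    simp

end Attack

theorem attack_correct_output (S : GroupGen) {N : Sizes} (A : ProverAdversary N) (κ : ℕ)
    (I : Finset (Fin (N.K κ))) (aux : Fin (A.auxLen κ) → Bool) (x : Fin (N.n κ) → ZMod (S.q κ))
    (sh : Fin (N.K κ) → Fin (N.n κ) → ZMod (S.q κ)) (hsh : ∀ i, ∑ k, sh k i = x i) :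
    (attackExp S A κ I aux x sh).map (fun o => (o.started, o.ideal)) =
      ((attackExp S A κ I aux x sh).map fun o => o.started).bind fun st =>
        (mBin (N.nb κ) fun k => ∑ i ∈ legal x, sh k i).map fun out => (st, out.1) := by
  simp only [attackExp, PMF.map_bind, PMF.bind_bind]
  congr 1
  funext pp
  simp only [PMF.map_comp, Function.comp_def]
  refine attack_ideal_independent _ _ _ _ _ _ _ _ ?_
  rw [Finset.sum_comm]
  exact Finset.sum_congr rfl fun i _ => (hsh i).symm

/-! ### Polynomial bounds -/

theorem PolyBounded.mono {f g : ℕ → ℕ} (hg : PolyBounded g) (h : ∀ κ, f κ ≤ g κ) :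
    PolyBounded f := by
  obtain ⟨p, hp⟩ := hg
  exact ⟨p, fun κ => (h κ).trans (hp κ)⟩

theorem PolyBounded.const (c : ℕ) : PolyBounded fun _ => c :=
  ⟨Polynomial.C c, fun κ => by simp⟩

theorem PolyBounded.add {f g : ℕ → ℕ} (hf : PolyBounded f) (hg : PolyBounded g) :
    PolyBounded fun κ => f κ + g κ := by
  obtain ⟨p, hp⟩ := hf
  obtain ⟨p', hp'⟩ := hg
  exact ⟨p + p', fun κ => by simpa using add_le_add (hp κ) (hp' κ)⟩

theorem PolyBounded.mul {f g : ℕ → ℕ} (hf : PolyBounded f) (hg : PolyBounded g) :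
    PolyBounded fun κ => f κ * g κ := by
  obtain ⟨p, hp⟩ := hf
  obtain ⟨p', hp'⟩ := hg
  exact ⟨p * p', fun κ => by simpa using Nat.mul_le_mul (hp κ) (hp' κ)⟩

/-! ### Circuit combinators -/

namespace Circ

variable {a b c : Ty} {n : ℕ}

/-- Compute `f` and continue with the old context and the value of `f`. -/
def letIn (f : Circ a b) (g : Circ (.prod a b) c) : Circ a c := .comp (.pair (.id a) f) g

/-- An entry of a tuple. -/
def entry (f : Circ a (.pow b n)) (i : Fin n) : Circ a b := .comp f (.proj b i)

/-- An entry of a matrix. -/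
def entry₂ {m : ℕ} (f : Circ a (.pow (.pow b n) m)) (i : Fin m) (j : Fin n) : Circ a b :=
  (f.entry i).entry j

def left (f : Circ a (.prod b c)) : Circ a b := .comp f (.fst b c)

def right (f : Circ a (.prod b c)) : Circ a c := .comp f (.snd b c)

def add (f g : Circ a .fld) : Circ a .fld := .comp (.pair f g) .fadd

def mul (f g : Circ a .fld) : Circ a .fld := .comp (.pair f g) .fmul

def sub (f g : Circ a .fld) : Circ a .fld := f.add ((fconst a (-1)).mul g)

def inv (f : Circ a .fld) : Circ a .fld := .comp f .finv

def ofBit (f : Circ a .bit) : Circ a .fld := .comp f .fofbit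

/-- A choice between two elements of `ℤ_q`. -/
def mux (f : Circ a .bit) (g g' : Circ a .fld) : Circ a .fld :=
  (f.ofBit.mul g).add ((ofBit (.comp f .bnot)).mul g')

def and (f g : Circ a .bit) : Circ a .bit := .comp (.pair f g) .band

def times (f g : Circ a .grp) : Circ a .grp := .comp (.pair f g) .gmul

def power (f : Circ a .grp) (g : Circ a .fld) : Circ a .grp := .comp (.pair f g) .gpow

def eqG (f g : Circ a .grp) : Circ a .bit := .comp (.pair f g) .geq

def sum : {n : ℕ} → (Fin n → Circ a .fld) → Circ a .fld
  | 0, _ => .fconst a 0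
  | _ + 1, f => (f 0).add (sum fun i => f i.succ)

def product : {n : ℕ} → (Fin n → Circ a .grp) → Circ a .grp
  | 0, _ => (ggen a).power (fconst a 0)
  | _ + 1, f => (f 0).times (product fun i => f i.succ)

/-- The Pedersen commitment to `m` with randomness `r` for the second generator `h`. -/
def commit (h : Circ a .grp) (m r : Circ a .fld) : Circ a .grp :=
  ((ggen a).power m).times (h.power r)

/-- The first entry of a tuple that is a discrete logarithm of `h`, and `0` if there is none. -/
def firstLog (h : Circ a .grp) : {n : ℕ} → (Fin n → Circ a .fld) → Circ a .fld
  | 0, _ => .fconst a 0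
  | _ + 1, f => mux (eqG ((ggen a).power (f 0)) h) (f 0) (firstLog h fun i => f i.succ)

/-- The final message of a prover. -/
def response {nb : ℕ} (L : Finset (Fin n)) (sh r : Fin n → Circ a .fld) (v s : Fin nb → Circ a .fld)
    (t : Fin nb → Circ a .bit) : Circ a (.prod .fld .fld) :=
  .pair
    ((sum fun i => if i ∈ L then sh i else .fconst a 0).add
      (sum fun j => mux (t j) ((fconst a 1).sub (v j)) (v j)))
    ((sum fun i => if i ∈ L then r i else .fconst a 0).add
      (sum fun j => mux (t j) ((fconst a 0).sub (s j)) (s j)))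

/-! ### Semantics of the derived circuits -/

section Eval

variable {q : ℕ} (P : PrimeGroup q) (u : a.El P)

@[simp] theorem eval_letIn (f : Circ a b) (g : Circ (.prod a b) c) :
    (f.letIn g).eval P u = g.eval P (u, f.eval P u) := rfl

@[simp] theorem eval_comp (f : Circ a b) (g : Circ b c) :
    (comp f g).eval P u = g.eval P (f.eval P u) := rfl

@[simp] theorem eval_id : (Circ.id a).eval P u = u := rfl

@[simp] theorem eval_pair (f : Circ a b) (g : Circ a c) :
    (pair f g).eval P u = (f.eval P u, g.eval P u) := rfl

@[simp] theorem eval_tup (f : Fin n → Circ a b) :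
    (tup f).eval P u = fun i => (f i).eval P u := rfl

@[simp] theorem eval_entry (f : Circ a (.pow b n)) (i : Fin n) :
    (f.entry i).eval P u = f.eval P u i := rfl

@[simp] theorem eval_entry₂ {m : ℕ} (f : Circ a (.pow (.pow b n) m)) (i : Fin m) (j : Fin n) :
    (f.entry₂ i j).eval P u = f.eval P u i j := rfl

@[simp] theorem eval_left (f : Circ a (.prod b c)) : f.left.eval P u = (f.eval P u).1 := rfl

@[simp] theorem eval_right (f : Circ a (.prod b c)) : f.right.eval P u = (f.eval P u).2 := rfl

@[simp] theorem eval_bconst (t : Bool) : (bconst a t).eval P u = t := rfl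

@[simp] theorem eval_fconst (t : ℤ) : (fconst a t).eval P u = (t : ZMod q) := rfl

@[simp] theorem eval_ggen : (ggen a).eval P u = P.gen := rfl

@[simp] theorem eval_and (f g : Circ a .bit) :
    (f.and g).eval P u = (f.eval P u && g.eval P u) := rfl

@[simp] theorem eval_add (f g : Circ a .fld) :
    (f.add g).eval P u = f.eval P u + g.eval P u := rfl

@[simp] theorem eval_mul (f g : Circ a .fld) :
    (f.mul g).eval P u = f.eval P u * g.eval P u := rfl

@[simp] theorem eval_sub (f g : Circ a .fld) :
    (f.sub g).eval P u = f.eval P u - g.eval P u := by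
  rw [sub, eval_add, eval_mul, eval_fconst]
  push_cast
  ring

@[simp] theorem eval_inv (f : Circ a .fld) :
    f.inv.eval P u = Inv.inv (α := ZMod q) (f.eval P u) := rfl

@[simp] theorem eval_ofBit (f : Circ a .bit) :
    f.ofBit.eval P u = (bitVal (f.eval P u) : ZMod q) := rfl

@[simp] theorem eval_mux (f : Circ a .bit) (g g' : Circ a .fld) :
    (f.mux g g').eval P u = if f.eval P u = true then g.eval P u else g'.eval P u := by
  have h : (ofBit (comp f bnot)).eval P u = (bitVal (!f.eval P u) : ZMod q) := rfl
  rw [mux, eval_add, eval_mul, eval_mul, h, eval_ofBit]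
  cases f.eval P u <;> simp [bitVal]

@[simp] theorem eval_times (f g : Circ a .grp) :
    (f.times g).eval P u = f.eval P u * g.eval P u := rfl

@[simp] theorem eval_power (f : Circ a .grp) (g : Circ a .fld) :
    (f.power g).eval P u = f.eval P u ^ ZMod.val (n := q) (g.eval P u) := rfl

@[simp] theorem eval_eqG (f g : Circ a .grp) :
    (f.eqG g).eval P u = true ↔ f.eval P u = g.eval P u := by
  have h : (f.eqG g).eval P u = (open Classical in decide (f.eval P u = g.eval P u)) := rfl
  simp only [h, decide_eq_true_eq]

@[simp] theorem eval_sum (f : Fin n → Circ a .fld) :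
    (sum f).eval P u = ∑ i, ((f i).eval P u : ZMod q) := by
  induction n with
  | zero => simp [sum]
  | succ n ih => rw [sum, eval_add, ih, Fin.sum_univ_succ]

@[simp] theorem eval_commit (h : Circ a .grp) (m r : Circ a .fld) :
    (commit h m r).eval P u = com P (h.eval P u) (m.eval P u) (r.eval P u) := rfl

@[simp] theorem eval_product (f : Fin n → Circ a .grp) :
    (product f).eval P u = ∏ i, ((f i).eval P u : P.carrier) := by
  induction n with
  | zero => simp [product]
  | succ n ih => rw [product, eval_times, ih, Fin.prod_univ_succ]

theorem eval_response {nb : ℕ} (L : Finset (Fin n)) (sh r : Fin n → Circ a .fld)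
    (v s : Fin nb → Circ a .fld) (t : Fin nb → Circ a .bit) :
    (response L sh r v s t).eval P u =
      (∑ i ∈ L, (sh i).eval P u +
          ∑ j, (if (t j).eval P u = true then 1 - (v j).eval P u else (v j).eval P u),
        ∑ i ∈ L, (r i).eval P u +
          ∑ j, (if (t j).eval P u = true then - (s j).eval P u else (s j).eval P u)) := by
  have h : ∀ f : Fin n → Circ a .fld,
      (sum fun i => if i ∈ L then f i else .fconst a 0).eval P u =
        ∑ i ∈ L, ((f i).eval P u : ZMod q) := by
    intro f
    rw [eval_sum, ← Finset.sum_subset (Finset.subset_univ L)]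
    · refine Finset.sum_congr rfl fun i hi => ?_
      rw [if_pos hi]
    · intro i _ hi
      rw [if_neg hi]
      simp
  simp [response, h]

/-- Injectivity of `exp` means that the test g^f = h passes only for f = z, so wrong candidates do
no harm. The default value 0 settles z = 0 whatever the candidates are. -/
theorem eval_firstLog [Fact q.Prime] (z : ZMod q) (h : Circ a .grp) (hz : h.eval P u = P.exp z)
    (f : Fin n → Circ a .fld) (hf : z = 0 ∨ ∃ i, (f i).eval P u = z) :
    (firstLog h f).eval P u = z := by
  induction n with
  | zero =>
    rcases hf with rfl | ⟨i, -⟩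
    · simp [firstLog]
    · exact i.elim0
  | succ n ih =>
    rw [firstLog, eval_mux]
    have key : (eqG ((ggen a).power (f 0)) h).eval P u = true ↔ (f 0).eval P u = z := by
      rw [eval_eqG, hz]
      exact P.exp_injective.eq_iff
    split_ifs with h0
    · exact key.mp h0
    · refine ih _ ?_
      rcases hf with rfl | ⟨i, hi⟩
      · exact Or.inl rfl
      · refine Or.inr ?_
        refine Fin.cases (fun h1 => absurd (key.mpr h1) h0) (fun i hi => ⟨i, hi⟩) i hi

end Eval

/-! ### Gate counts -/

section Size

-- The value of `f` is computed once however often `g` reads it, so sizes add along a chain of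
-- stages. This keeps the reduction and the simulator polynomial.
@[simp] theorem size_letIn (f : Circ a b) (g : Circ (.prod a b) c) :
    (f.letIn g).size = f.size + g.size + 2 := by
  simp [letIn, size]
  ring

@[simp] theorem size_comp (f : Circ a b) (g : Circ b c) :
    (comp f g).size = f.size + g.size := rfl

@[simp] theorem size_pair (f : Circ a b) (g : Circ a c) :
    (pair f g).size = f.size + g.size + 1 := rfl

@[simp] theorem size_id : (Circ.id a).size = 1 := rfl

@[simp] theorem size_entry (f : Circ a (.pow b n)) (i : Fin n) :
    (f.entry i).size = f.size + 1 := rfl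

@[simp] theorem size_entry₂ {m : ℕ} (f : Circ a (.pow (.pow b n) m)) (i : Fin m) (j : Fin n) :
    (f.entry₂ i j).size = f.size + 2 := rfl

@[simp] theorem size_left (f : Circ a (.prod b c)) : f.left.size = f.size + 1 := rfl

@[simp] theorem size_right (f : Circ a (.prod b c)) : f.right.size = f.size + 1 := rfl

@[simp] theorem size_bconst (t : Bool) : (bconst a t).size = 1 := rfl

@[simp] theorem size_fconst (t : ℤ) : (fconst a t).size = 1 := rfl

@[simp] theorem size_ggen : (ggen a).size = 1 := rfl

@[simp] theorem size_and (f g : Circ a .bit) : (f.and g).size = f.size + g.size + 2 := rfl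

@[simp] theorem size_add (f g : Circ a .fld) : (f.add g).size = f.size + g.size + 2 := rfl

@[simp] theorem size_mul (f g : Circ a .fld) : (f.mul g).size = f.size + g.size + 2 := rfl

@[simp] theorem size_sub (f g : Circ a .fld) : (f.sub g).size = f.size + g.size + 5 := by
  simp [sub]
  ring

@[simp] theorem size_inv (f : Circ a .fld) : f.inv.size = f.size + 1 := rfl

@[simp] theorem size_ofBit (f : Circ a .bit) : f.ofBit.size = f.size + 1 := rfl

@[simp] theorem size_mux (f : Circ a .bit) (g g' : Circ a .fld) :
    (f.mux g g').size = 2 * f.size + g.size + g'.size + 9 := by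
  have : (Circ.bnot).size = 1 := rfl
  simp [mux, this]
  ring

@[simp] theorem size_times (f g : Circ a .grp) : (f.times g).size = f.size + g.size + 2 := rfl

@[simp] theorem size_power (f : Circ a .grp) (g : Circ a .fld) :
    (f.power g).size = f.size + g.size + 2 := rfl

@[simp] theorem size_eqG (f g : Circ a .grp) : (f.eqG g).size = f.size + g.size + 2 := rfl

@[simp] theorem size_commit (h : Circ a .grp) (m r : Circ a .fld) :
    (commit h m r).size = h.size + m.size + r.size + 7 := by
  simp [commit]
  ring

theorem size_tup_le {f : Fin n → Circ a b} (B : ℕ) (hf : ∀ i, (f i).size ≤ B) :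
    (tup f).size ≤ n * B + 1 := by
  have := Finset.sum_le_card_nsmul Finset.univ (fun i => (f i).size) B fun i _ => hf i
  simpa [size] using this

theorem size_tup_tup_le {m : ℕ} {f : Fin m → Fin n → Circ a b} (B : ℕ)
    (hf : ∀ i j, (f i j).size ≤ B) : (tup fun i => tup fun j => f i j).size ≤ m * (n * B + 1) + 1 :=
  size_tup_le _ fun i => size_tup_le B (hf i)

theorem size_sum_le {f : Fin n → Circ a .fld} (B : ℕ) (hf : ∀ i, (f i).size ≤ B) :
    (sum f).size ≤ n * (B + 2) + 1 := by
  induction n with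
  | zero => simp [sum]
  | succ n ih =>
    have h1 := ih fun i => hf i.succ
    have h0 := hf 0
    rw [sum, size_add, add_mul]
    omega

theorem size_product_le {f : Fin n → Circ a .grp} (B : ℕ) (hf : ∀ i, (f i).size ≤ B) :
    (product f).size ≤ n * (B + 2) + 4 := by
  induction n with
  | zero => simp [product]
  | succ n ih =>
    have h1 := ih fun i => hf i.succ
    have h0 := hf 0
    rw [product, size_times, add_mul]
    omega

theorem size_firstLog_le {h : Circ a .grp} {f : Fin n → Circ a .fld} (B : ℕ)
    (hf : ∀ i, (f i).size ≤ B) : (firstLog h f).size ≤ n * (3 * B + 2 * h.size + 19) + 1 := by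
  induction n with
  | zero => simp [firstLog]
  | succ n ih =>
    have h1 := ih fun i => hf i.succ
    have h0 := hf 0
    rw [firstLog, size_mux, size_eqG, size_power, size_ggen, add_mul]
    omega

theorem size_response_le {nb : ℕ} {L : Finset (Fin n)} {sh r : Fin n → Circ a .fld}
    {v s : Fin nb → Circ a .fld} {t : Fin nb → Circ a .bit} (B : ℕ) (hB : 1 ≤ B)
    (hsh : ∀ i, (sh i).size ≤ B) (hr : ∀ i, (r i).size ≤ B) (hv : ∀ j, (v j).size ≤ B)
    (hs : ∀ j, (s j).size ≤ B) (ht : ∀ j, (t j).size ≤ B) :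
    (response L sh r v s t).size ≤ 2 * (n * (B + 2) + nb * (4 * B + 17)) + 9 := by
  have h1 : ∀ f : Fin n → Circ a .fld, (∀ i, (f i).size ≤ B) →
      (sum fun i => if i ∈ L then f i else .fconst a 0).size ≤ n * (B + 2) + 1 := by
    intro f hf
    refine size_sum_le B fun i => ?_
    split_ifs
    · exact hf i
    · exact hB
  have h2 : ∀ (z : ℤ) (f : Fin nb → Circ a .fld), (∀ i, (f i).size ≤ B) →
      (sum fun j => mux (t j) ((fconst a z).sub (f j)) (f j)).size ≤ nb * (4 * B + 17) + 1 := by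
    intro z f hf
    refine size_sum_le (4 * B + 15) fun j => ?_
    have := hf j
    have := ht j
    simp only [size_mux, size_sub, size_fconst]
    omega
  have e1 := h1 sh hsh
  have e2 := h1 r hr
  have e3 := h2 1 v hv
  have e4 := h2 0 s hs
  simp only [response, size_pair, size_add]
  omega

end Size

end Circ

/-! ### Reading randomness off a tape -/

section Tape

/-- The values of a uniform function at distinct positions are independent and uniform; unread
positions of a tape are discarded. -/
theorem preservesUniform_precomp {ι κ α : Type} [Fintype α] [Nonempty α] [Fintype ι] [Fintype κ]
    [DecidableEq ι] [DecidableEq κ] {g : ι → κ} (hg : Function.Injective g) :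
    PreservesUniform fun (f : κ → α) i => f (g i) := by
  classical
  have h1 := preservesUniform_equiv (Equiv.piEquivPiSubtypeProd (fun x => x ∈ Set.range g)
    fun _ => α)
  have h2 : PreservesUniform fun (f : {x // x ∈ Set.range g} → α) (i : ι) =>
      f ⟨g i, Set.mem_range_self i⟩ :=
    preservesUniform_equiv (Equiv.arrowCongr (Equiv.ofInjective g hg).symm (Equiv.refl α))
  exact h2.comp (preservesUniform_fst.comp h1)

/-- Names for the random bits and field elements of an execution with corrupted provers. -/
abbrev CoinIdx (n nb K m : ℕ) : Type :=
  Fin m ⊕ (Fin K × Fin n) ⊕ (Fin K × Fin nb) ⊕ (Fin K × Fin nb)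

/-- The number of coins of the reduction. -/
abbrev coinCount (n nb K m : ℕ) : ℕ := Fintype.card (CoinIdx n nb K m)

/-- The position of a coin on the tape. -/
noncomputable def coinPos {n nb K m : ℕ} (c : CoinIdx n nb K m) : Fin (coinCount n nb K m) :=
  Fintype.equivFin _ c

theorem coinPos_injective {n nb K m : ℕ} : Function.Injective (coinPos (n := n) (nb := nb) (K := K)
    (m := m)) := (Fintype.equivFin _).injective

/-- The randomness of an execution, read off a tape. -/
noncomputable def unpackTape {q n nb K m : ℕ}
    (t : (Fin (coinCount n nb K m) → Bool) × (Fin (coinCount n nb K m) → ZMod q)) :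
    ((Fin m → Bool) × (Fin m → ZMod q)) × PartyRand q n nb K :=
  ((fun i => t.1 (coinPos (.inl i)), fun i => t.2 (coinPos (.inl i))),
    fun k i => t.2 (coinPos (.inr (.inl (k, i)))),
    fun k j => t.1 (coinPos (.inr (.inr (.inl (k, j))))),
    fun k j => t.2 (coinPos (.inr (.inr (.inl (k, j))))),
    fun k j => t.1 (coinPos (.inr (.inr (.inr (k, j))))))

theorem preservesUniform_splitSum {ι₁ ι₂ ι₃ ι₃' κ α : Type} [Fintype α] [Nonempty α]
    [Fintype ι₁] [Fintype ι₂] [Fintype ι₃] [Fintype ι₃'] [Fintype κ]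
    [DecidableEq ι₁] [DecidableEq ι₂] [DecidableEq ι₃] [DecidableEq ι₃'] [DecidableEq κ]
    {ι₂' : Type} [Fintype ι₂'] [DecidableEq ι₂']
    {g : ι₁ ⊕ (ι₂ × ι₂') ⊕ (ι₃ × ι₃') → κ} (hg : Function.Injective g) :
    PreservesUniform fun f : κ → α => ((fun i => f (g (.inl i))),
      (fun i j => f (g (.inr (.inl (i, j))))), fun i j => f (g (.inr (.inr (i, j))))) := by
  have h1 := preservesUniform_precomp (α := α) hg
  have h2 := preservesUniform_equiv ((Equiv.sumArrowEquivProdArrow ι₁ ((ι₂ × ι₂') ⊕ (ι₃ × ι₃')) α).trans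
    ((Equiv.refl _).prodCongr ((Equiv.sumArrowEquivProdArrow (ι₂ × ι₂') (ι₃ × ι₃') α).trans
      ((Equiv.curry ι₂ ι₂' α).prodCongr (Equiv.curry ι₃ ι₃' α)))))
  exact h2.comp h1

theorem preservesUniform_unpackTape {q n nb K m : ℕ} [Fact q.Prime] :
    PreservesUniform (unpackTape (q := q) (n := n) (nb := nb) (K := K) (m := m)) := by
  -- The bit tape supplies the adversary's bits, v and b; the field tape below supplies its field
  -- elements, r and s. A bit v and its s share a position name, but lie on independent tapes.
  have hb := preservesUniform_splitSum (α := Bool) (κ := Fin (coinCount n nb K m))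
    (g := fun c : Fin m ⊕ (Fin K × Fin nb) ⊕ (Fin K × Fin nb) =>
      coinPos (Sum.map id Sum.inr c : CoinIdx n nb K m))
    (coinPos_injective.comp (Sum.map_injective.mpr ⟨Function.injective_id, Sum.inr_injective⟩))
  have hf := preservesUniform_splitSum (α := ZMod q) (κ := Fin (coinCount n nb K m))
    (g := fun c : Fin m ⊕ (Fin K × Fin n) ⊕ (Fin K × Fin nb) =>
      coinPos (Sum.map id (Sum.map id Sum.inl) c : CoinIdx n nb K m))
    (coinPos_injective.comp (Sum.map_injective.mpr ⟨Function.injective_id,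
      Sum.map_injective.mpr ⟨Function.injective_id, Sum.inl_injective⟩⟩))
  have hp : PreservesUniform fun u : ((Fin m → Bool) × (Fin K → Fin nb → Bool) ×
      (Fin K → Fin nb → Bool)) × ((Fin m → ZMod q) × (Fin K → Fin n → ZMod q) ×
        (Fin K → Fin nb → ZMod q)) =>
      (((u.1.1, u.2.1), u.2.2.1, u.1.2.1, u.2.2.2, u.1.2.2) :
        ((Fin m → Bool) × (Fin m → ZMod q)) × PartyRand q n nb K) := by
    apply preservesUniform_of_bijective
    constructor
    · rintro ⟨⟨a, b, c⟩, d, e, f⟩ ⟨⟨a', b', c'⟩, d', e', f'⟩ h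
      simp only [Prod.mk.injEq] at h ⊢
      tauto
    · rintro ⟨⟨a, b⟩, c, d, e, f⟩
      exact ⟨((a, d, f), b, c, e), rfl⟩
  exact hp.comp (hb.prodMap hf)

theorem coinCount_eq (n nb K m : ℕ) : coinCount n nb K m = m + (K * n + (K * nb + K * nb)) := by
  simp [coinCount]

end Tape

/-! ### The reduction to discrete logarithms -/

namespace ProverAttack

variable {n nb K m l : ℕ} (A : ProverAttack n nb K m l) (I : Finset (Fin K)) (aux : Fin l → Bool)
  (L : Finset (Fin n)) (sh : Fin K → Fin n → ℤ)

/-- The input of the reduction. -/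
@[reducible] def Input (n nb K m : ℕ) : Ty := .prod (.tape (coinCount n nb K m)) .grp

/-- The view of the corrupted provers. -/
@[reducible] def View (n nb K m l : ℕ) : Ty := .prod (.start n K m l) (.pow (.pow .grp nb) K)

/-- The commitments of the corrupted provers with their openings. -/
@[reducible] def Openings (nb K : ℕ) : Ty := .pow (.pow (.prod .grp (.prod .fld .fld)) nb) K

variable {a : Ty} (inp : Circ a (Input n nb K m))

noncomputable def bitCoin (c : CoinIdx n nb K m) : Circ a .bit := inp.left.left.entry (coinPos c)

noncomputable def fldCoin (c : CoinIdx n nb K m) : Circ a .fld := inp.left.right.entry (coinPos c)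

/-- The view of the corrupted provers, computed from the tape and the group element `h`. -/
noncomputable def viewCirc : Circ (Input n nb K m) (View n nb K m l) :=
  .pair
    (.pair (.pair (.tup fun i => bitCoin (.id _) (.inl i)) (.tup fun i => fldCoin (.id _) (.inl i)))
      (.pair (.tup fun i => .bconst _ (aux i)) (.pair (Circ.id _).right
        (.pair
          (.tup fun k => .tup fun i => if k ∈ I
            then .pair (.fconst _ (sh k i)) (fldCoin (.id _) (.inr (.inl (k, i))))
            else .pair (.fconst _ 0) (.fconst _ 0))
          (.pair
            (.tup fun k => .tup fun i => .commit (Circ.id _).right (.fconst _ (sh k i))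
              (fldCoin (.id _) (.inr (.inl (k, i)))))
            (.tup fun i => .bconst _ (decide (i ∈ L))))))))
    (.tup fun k => .tup fun j => if k ∈ I then (Circ.ggen _).power (.fconst _ 0)
      else .commit (Circ.id _).right (bitCoin (.id _) (.inr (.inr (.inl (k, j))))).ofBit
        (fldCoin (.id _) (.inr (.inr (.inl (k, j))))))

/-- The final messages of the honest provers; blanked for corrupted provers. -/
noncomputable def honestCirc : Circ a (.pow (.prod .fld .fld) K) :=
  .tup fun k => if k ∈ I then .pair (.fconst _ 0) (.fconst _ 0) else
    .response L (fun i => .fconst _ (sh k i)) (fun i => fldCoin inp (.inr (.inl (k, i))))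
      (fun j => (bitCoin inp (.inr (.inr (.inl (k, j))))).ofBit)
      (fun j => fldCoin inp (.inr (.inr (.inl (k, j)))))
      (fun j => bitCoin inp (.inr (.inr (.inr (k, j)))))

/-- The openings that the commitments of the corrupted prover `k` determine. -/
noncomputable def expectedCirc (op : Circ a (Openings nb K)) (k : Fin K) :
    Circ a (.prod .fld .fld) :=
  .response L (fun i => .fconst _ (sh k i)) (fun i => fldCoin inp (.inr (.inl (k, i))))
    (fun j => (op.entry₂ k j).right.left) (fun j => (op.entry₂ k j).right.right)
    (fun j => bitCoin inp (.inr (.inr (.inr (k, j)))))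

/-- The quotient of the differences of two openings. -/
def quotCirc : Circ (.prod (.prod .fld .fld) (.prod .fld .fld)) .fld :=
  ((Circ.id _).right.left.sub (Circ.id _).left.left).mul
    ((Circ.id _).left.right.sub (Circ.id _).right.right).inv

/-- The candidate for the discrete logarithm that the prover `k` provides. -/
noncomputable def candidateCirc (op : Circ a (Openings nb K)) (resp : Circ a (.pow (.prod .fld .fld) K))
    (k : Fin K) : Circ a .fld :=
  if k ∈ I then .comp (.pair (expectedCirc L sh inp op k) (resp.entry k)) quotCirc
  else .fconst _ 0

/-- The circuit that computes a discrete logarithm from a cheating prover. -/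
noncomputable def solveCirc : Circ (Input n nb K m) .fld :=
  (viewCirc I aux L sh).letIn <|
  (Circ.comp (Circ.id _).right A.commit).letIn <|
  (Circ.comp (.pair (Circ.id _).left.right
    (.pair (.tup fun k => .tup fun j => bitCoin (Circ.id _).left.left (.inr (.inr (.inr (k, j)))))
      (honestCirc I L sh (Circ.id _).left.left))) A.respond).letIn <|
  (Circ.tup (candidateCirc I L sh (Circ.id _).left.left.left (Circ.id _).left.right
    (Circ.id _).right)).letIn <|
  .firstLog (Circ.id _).left.left.left.left.right fun k => (Circ.id _).right.entry k

theorem size_viewCirc_le :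
    (viewCirc I aux L sh : Circ (Input n nb K m) (View n nb K m l)).size ≤
      m * 4 + m * 4 + l + K * (n * 6 + 1) + K * (n * 14 + 1) + n + K * (nb * 18 + 1) + 20 := by
  have h1 := Circ.size_tup_le (n := m) (f := fun i => bitCoin (nb := nb) (n := n) (K := K)
    (.id _) (.inl i)) 4 fun i => le_of_eq rfl
  have h2 := Circ.size_tup_le (n := m) (f := fun i => fldCoin (nb := nb) (n := n) (K := K)
    (.id _) (.inl i)) 4 fun i => le_of_eq rfl
  have h3 := Circ.size_tup_le (n := l) (f := fun i => .bconst (Input n nb K m) (aux i)) 1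
    fun i => le_of_eq rfl
  have h4 := Circ.size_tup_tup_le (f := fun (k : Fin K) (i : Fin n) => if k ∈ I
    then Circ.pair (.fconst (Input n nb K m) (sh k i)) (fldCoin (.id _) (.inr (.inl (k, i))))
    else .pair (.fconst _ 0) (.fconst _ 0)) 6 fun k i => by
      split_ifs <;> simp [fldCoin]
  have h5 := Circ.size_tup_tup_le (f := fun (k : Fin K) (i : Fin n) =>
    Circ.commit (Circ.id (Input n nb K m)).right (.fconst _ (sh k i))
      (fldCoin (.id _) (.inr (.inl (k, i))))) 14 fun k i => by simp [fldCoin]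
  have h6 := Circ.size_tup_le (n := n) (f := fun i => .bconst (Input n nb K m) (decide (i ∈ L))) 1
    fun i => le_of_eq rfl
  have h7 := Circ.size_tup_tup_le (f := fun (k : Fin K) (j : Fin nb) => if k ∈ I
    then (Circ.ggen (Input n nb K m)).power (.fconst _ 0)
      else .commit (Circ.id _).right (bitCoin (.id _) (.inr (.inr (.inl (k, j))))).ofBit
        (fldCoin (.id _) (.inr (.inr (.inl (k, j)))))) 18 fun k j => by
      split_ifs <;> simp [fldCoin, bitCoin]
  simp only [viewCirc, Circ.size_pair, Circ.size_right, Circ.size_id]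
  simp only [Input] at h1 h2 h3 h4 h5 h6 h7 ⊢
  omega

theorem size_honestCirc_le (s : ℕ) (hs : inp.size ≤ s) :
    (honestCirc I L sh inp).size ≤
      K * (2 * (n * (s + 6) + nb * (4 * (s + 4) + 17)) + 9) + 1 := by
  refine Circ.size_tup_le _ fun k => ?_
  split_ifs
  · simp only [Circ.size_pair, Circ.size_fconst]
    omega
  · refine Circ.size_response_le (s + 4) (by omega) ?_ ?_ ?_ ?_ ?_ <;> intro i <;>
      simp [fldCoin, bitCoin] <;> omega

theorem size_candidateCirc_le (op : Circ a (Openings nb K))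
    (resp : Circ a (.pow (.prod .fld .fld) K)) (s : ℕ) (h1 : inp.size ≤ s) (h2 : op.size ≤ s)
    (h3 : resp.size ≤ s) (k : Fin K) :
    (candidateCirc I L sh inp op resp k).size ≤
      2 * (n * (s + 6) + nb * (4 * (s + 4) + 17)) + s + 50 := by
  have h : (expectedCirc L sh inp op k).size ≤
      2 * (n * (s + 6) + nb * (4 * (s + 4) + 17)) + 9 := by
    refine Circ.size_response_le (s + 4) (by omega) ?_ ?_ ?_ ?_ ?_ <;> intro i <;>
      simp [fldCoin, bitCoin] <;> omega
  unfold candidateCirc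
  split_ifs
  · simp only [quotCirc, Circ.size_comp, Circ.size_pair, Circ.size_entry, Circ.size_mul, Circ.size_sub,
      Circ.size_inv, Circ.size_left, Circ.size_right, Circ.size_id]
    omega
  · simp only [Circ.size_fconst]
    omega

/-- Each summand bounds one stage of the circuit. The small constants come from the projections that
reach an earlier value through the nested contexts. -/
theorem size_solveCirc_le :
    (solveCirc A I aux L sh).size ≤
      (m * 4 + m * 4 + l + K * (n * 6 + 1) + K * (n * 14 + 1) + n + K * (nb * 18 + 1) + 20) +
      A.commit.size + A.respond.size + (K * (nb * 6 + 1) + 1) +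
      (K * (2 * (n * 9 + nb * 45) + 9) + 1) +
      (K * (2 * (n * 10 + nb * 49) + 4 + 50) + 1) + (K * 50 + 1) + 30 := by
  have h1 := size_viewCirc_le (m := m) (nb := nb) I aux L sh
  have h2 := size_honestCirc_le I L sh (a := .prod (.prod (Input n nb K m) (View n nb K m l))
    (Openings nb K)) (Circ.id _).left.left 3 (le_of_eq rfl)
  have h3 := Circ.size_tup_le _ (size_candidateCirc_le I L sh
    (a := .prod (.prod (.prod (Input n nb K m) (View n nb K m l))
    (Openings nb K)) (.pow (.prod .fld .fld) K)) (Circ.id _).left.left.left (Circ.id _).left.right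
    (Circ.id _).right 4 (le_of_eq rfl) (by simp) (by simp))
  have h4 := Circ.size_firstLog_le (a := .prod (.prod (.prod (.prod (Input n nb K m)
    (View n nb K m l)) (Openings nb K)) (.pow (.prod .fld .fld) K)) (.pow .fld K))
    (h := (Circ.id _).left.left.left.left.right) (f := fun k => (Circ.id _).right.entry k) 3
    fun i => le_of_eq rfl
  have h5 := Circ.size_tup_tup_le (a := .prod (.prod (Input n nb K m) (View n nb K m l))
    (Openings nb K)) (f := fun (k : Fin K) (j : Fin nb) =>
      bitCoin (n := n) (m := m) (Circ.id _).left.left (.inr (.inr (.inr (k, j))))) 6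
    fun i j => le_of_eq rfl
  simp only [Circ.size_right, Circ.size_left, Circ.size_id] at h4
  simp only [solveCirc, Circ.size_letIn, Circ.size_comp, Circ.size_pair, Circ.size_right,
    Circ.size_left, Circ.size_id]
  simp only [Input, View, Openings, Nat.reduceAdd, Nat.reduceMul] at h1 h2 h3 h4 h5 ⊢
  omega

end ProverAttack

/-! ### Correctness of the reduction circuit -/

namespace ProverAttack

section Eval

variable {n nb K m l : ℕ} (A : ProverAttack n nb K m l) (I : Finset (Fin K)) (aux : Fin l → Bool)
  {q : ℕ} [Fact q.Prime] (P : PrimeGroup q) (x : Fin n → ZMod q) (sh : Fin K → Fin n → ℤ)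
  (z : ZMod q)
  (t : (Fin (coinCount n nb K m) → Bool) × (Fin (coinCount n nb K m) → ZMod q))

/-- By `valid_eq` the validity bits are constants given x, so they can be wired into the circuit, as
can the shares and the auxiliary input. The secret exponent of h is never needed. -/
theorem eval_viewCirc (hsh : ∀ i, ∑ k, (sh k i : ZMod q) = x i) :
    (viewCirc I aux (legal x) sh : Circ (Input n nb K m) (View n nb K m l)).eval P (t, P.exp z) =
      attackView P (P.exp z) I aux x (fun k i => (sh k i : ZMod q)) (unpackTape t) := by
  have h1 : (fun i => decide (i ∈ legal x)) =
      valid P (P.exp z) x (fun k i => (sh k i : ZMod q)) (unpackTape (K := K) (nb := nb) t).2.1 := by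
    funext i
    rw [P.valid_eq z x _ _ hsh]
    simp [legal]
  refine Prod.ext (Prod.ext rfl (Prod.ext rfl (Prod.ext rfl (Prod.ext ?_ (Prod.ext rfl h1))))) ?_
  · funext k i
    simp only [viewCirc, attackView, startView, Circ.eval_pair, Circ.eval_tup]
    split_ifs
    · rfl
    · simp
  · funext k j
    simp only [viewCirc, attackView, honestComs, Circ.eval_pair, Circ.eval_tup]
    split_ifs
    · simp
    · rfl

variable {a : Ty} (inp : Circ a (Input n nb K m)) (u : a.El P)

theorem eval_honestCirc (hu : inp.eval P u = (t, P.exp z))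
    (hsh : ∀ i, ∑ k, (sh k i : ZMod q) = x i) :
    (honestCirc I (legal x) sh inp).eval P u = fun k => if k ∈ I then (0, 0) else
      honestResponse P (P.exp z) x (fun k i => (sh k i : ZMod q)) (unpackTape (m := m) t) k := by
  funext k
  simp only [honestCirc, Circ.eval_tup]
  split_ifs
  · simp
  · simp only [Circ.eval_response, honestResponse, _root_.response, P.valid_filter z x _ _ hsh]
    simp only [fldCoin, bitCoin, Circ.eval_entry, Circ.eval_left, Circ.eval_right, Circ.eval_fconst,
      Circ.eval_ofBit, hu]
    rfl

theorem eval_candidateCirc (hu : inp.eval P u = (t, P.exp z))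
    (op : Circ a (Openings nb K)) (resp : Circ a (.pow (.prod .fld .fld) K)) (k : Fin K)
    (hk : k ∈ I)
    (hop : op.eval P u = A.commit.eval P
      (attackView P (P.exp z) I aux x (fun k i => (sh k i : ZMod q)) (unpackTape t)))
    (hresp : resp.eval P u = A.respond.eval P
      (attackView P (P.exp z) I aux x (fun k i => (sh k i : ZMod q)) (unpackTape t),
        (unpackTape (n := n) (m := m) t).2.2.2.2, fun k => if k ∈ I then (0, 0) else
          honestResponse P (P.exp z) x (fun k i => (sh k i : ZMod q)) (unpackTape (m := m) t) k)) :
    (candidateCirc I (legal x) sh inp op resp k).eval P u =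
      extracted P (P.exp z) A I aux x (fun k i => (sh k i : ZMod q)) (unpackTape t) k := by
  have h1 : (expectedCirc (legal x) sh inp op k).eval P u =
      expectedResponse P (P.exp z) A I aux x (fun k i => (sh k i : ZMod q)) (unpackTape t) k := by
    simp only [expectedCirc, Circ.eval_response, expectedResponse, attackOpening, if_pos hk]
    simp only [fldCoin, bitCoin, Circ.eval_entry, Circ.eval_entry₂, Circ.eval_left, Circ.eval_right,
      Circ.eval_fconst, hu, hop]
    rfl
  have h2 : (resp.entry k).eval P u =
      attackResponse P (P.exp z) A I aux x (fun k i => (sh k i : ZMod q)) (unpackTape t) k := by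
    rw [Circ.eval_entry, hresp, attackResponse, if_pos hk]
  rw [candidateCirc, if_pos hk, Circ.eval_comp, Circ.eval_pair, h1, h2]
  simp only [quotCirc, Circ.eval_mul, Circ.eval_sub, Circ.eval_inv, Circ.eval_left, Circ.eval_right,
    Circ.eval_id]
  rfl

/-- A successful cheat makes one candidate correct; for z = 0 no cheat is required. The second case
is what pays for excluding a = 0 in `Setup`. -/
theorem eval_solveCirc (hsh : ∀ i, ∑ k, (sh k i : ZMod q) = x i)
    (h : z = 0 ∨
      ((attackOutcome P (P.exp z) A I aux x (fun k i => (sh k i : ZMod q)) (unpackTape t)).accept =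
        true ∧
      (attackOutcome P (P.exp z) A I aux x (fun k i => (sh k i : ZMod q)) (unpackTape t)).y ≠
      (attackOutcome P (P.exp z) A I aux x (fun k i => (sh k i : ZMod q)) (unpackTape t)).ideal)) :
    (solveCirc A I aux (legal x) sh).eval P (t, P.exp z) = z := by
  simp only [solveCirc, Circ.eval_letIn, Circ.eval_comp, Circ.eval_right, Circ.eval_id,
    eval_viewCirc I aux P x sh z t hsh]
  refine Circ.eval_firstLog P _ z _ rfl _ (h.imp id fun hc => ?_)
  obtain ⟨k, hk, he⟩ := extracted_of_cheat P A I aux x _ z hsh _ hc.1 hc.2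
  refine ⟨k, Eq.trans ?_ he⟩
  rw [Circ.eval_entry, Circ.eval_right, Circ.eval_id, Circ.eval_tup]
  refine eval_candidateCirc A I aux P x sh z t _ _ rfl _ _ k hk rfl ?_
  exact congrArg (fun v => A.respond.eval P (attackView P (P.exp z) I aux x
    (fun k i => (sh k i : ZMod q)) (unpackTape t), (unpackTape (n := n) (m := m) t).2.2.2.2, v))
    (eval_honestCirc I P x sh z t (a := .prod (.prod (Input n nb K m) (View n nb K m l))
      (Openings nb K)) (Circ.id _).left.left _ rfl hsh)

end Eval

end ProverAttack

/-- A bound on a probability over the units of `ℤ_q` by one over `ℤ_q`, for an event that always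
holds at `0`. -/
theorem uniform_units_le {q : ℕ} [Fact q.Prime] {Ω : Type} [Fintype Ω] [Nonempty Ω]
    (f : (ZMod q)ˣ × Ω → Bool) (g : ZMod q × Ω → Bool) (h0 : ∀ ω, g (0, ω) = true)
    (hfg : ∀ a ω, f (a, ω) = true → g (a, ω) = true) :
    (PMF.uniformOfFintype ((ZMod q)ˣ × Ω)).map f true ≤
      (PMF.uniformOfFintype (ZMod q × Ω)).map g true := by
  classical
  rw [uniform_map_apply_true, uniform_map_apply_true]
  set F := Finset.univ.filter fun a => f a = true
  set G := Finset.univ.filter fun a => g a = true with hG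
  have hcu : Fintype.card (ZMod q)ˣ = q - 1 := ZMod.card_units q
  have hF1 : F.card ≤ (q - 1) * Fintype.card Ω := by
    rw [← hcu, ← Fintype.card_prod]
    exact Finset.card_le_univ _
  -- The winning set contains the whole fibre over 0 and, disjointly from it, a copy of the event
  -- over the units.
  have hG1 : Fintype.card Ω + F.card ≤ G.card := by
    have hd : Disjoint (Finset.univ.map (Function.Embedding.sectR (0 : ZMod q) Ω))
        (F.map ((⟨_, Units.val_injective⟩ : (ZMod q)ˣ ↪ ZMod q).prodMap
          (Function.Embedding.refl Ω))) := by
      rw [Finset.disjoint_left]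
      intro u hu hu'
      simp only [Finset.mem_map, Finset.mem_univ, true_and] at hu hu'
      obtain ⟨ω, rfl⟩ := hu
      obtain ⟨w, -, hw⟩ := hu'
      exact w.1.ne_zero (congrArg Prod.fst hw)
    rw [← Finset.card_univ, ← Finset.card_map (Function.Embedding.sectR (0 : ZMod q) Ω),
      ← Finset.card_map (s := F) ((⟨_, Units.val_injective⟩ : (ZMod q)ˣ ↪ ZMod q).prodMap
          (Function.Embedding.refl Ω)), ← Finset.card_union_of_disjoint hd]
    refine Finset.card_le_card fun u hu => ?_
    rw [Finset.mem_union, Finset.mem_map, Finset.mem_map] at hu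
    rw [hG, Finset.mem_filter]
    refine ⟨Finset.mem_univ _, ?_⟩
    rcases hu with ⟨ω, -, rfl⟩ | ⟨w, hw, rfl⟩
    · exact h0 ω
    · exact hfg _ _ (Finset.mem_filter.mp hw).2
  have hq2 : 2 ≤ q := (Fact.out : q.Prime).two_le
  have hR : 0 < Fintype.card Ω := Fintype.card_pos
  rw [Fintype.card_prod, Fintype.card_prod, hcu, ZMod.card, ← div_eq_mul_inv, ← div_eq_mul_inv]
  -- With |G| ≥ |Ω| + |F| this reduces to |F| ≤ (q - 1)|Ω|: averaging in a sure event of weight 1/q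
  -- cannot lower a probability.
  have key : F.card * (q * Fintype.card Ω) ≤ G.card * ((q - 1) * Fintype.card Ω) := by
    obtain ⟨p, rfl⟩ : ∃ p, q = p + 1 := ⟨q - 1, by omega⟩
    simp only [Nat.add_sub_cancel] at hF1 ⊢
    nlinarith
  have hne1 : (((q - 1) * Fintype.card Ω : ℕ) : ENNReal) ≠ 0 := by
    have : 0 < (q - 1) * Fintype.card Ω := Nat.mul_pos (by omega) hR
    exact_mod_cast this.ne'
  have hne2 : ((q * Fintype.card Ω : ℕ) : ENNReal) ≠ 0 := by
    have : 0 < q * Fintype.card Ω := Nat.mul_pos (by omega) hR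
    exact_mod_cast this.ne'
  rw [ENNReal.div_le_iff hne1 (ENNReal.natCast_ne_top _), ← ENNReal.mul_div_right_comm,
    ENNReal.le_div_iff_mul_le (Or.inl hne2) (Or.inl (ENNReal.natCast_ne_top _))]
  exact_mod_cast key

/-- The discrete logarithm adversary built from an adversary that controls provers. -/
noncomputable def ProverAdversary.reduction {N : Sizes} (A : ProverAdversary N)
    (I : ∀ κ, Finset (Fin (N.K κ))) (aux : ∀ κ, Fin (A.auxLen κ) → Bool)
    (L : ∀ κ, Finset (Fin (N.n κ))) (sh : ∀ κ, Fin (N.K κ) → Fin (N.n κ) → ℤ) : DLAdversary where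
  coins κ := coinCount (N.n κ) (N.nb κ) (N.K κ) (A.coins κ)
  solve κ := (A.alg κ).solveCirc (I κ) (aux κ) (L κ) (sh κ)
  coins_poly := by
    simp only [coinCount_eq]
    exact A.coins_poly.add ((N.K_poly.mul N.n_poly).add
      ((N.K_poly.mul N.nb_poly).add (N.K_poly.mul N.nb_poly)))
  solve_poly := by
    refine PolyBounded.mono ?_ fun κ => ProverAttack.size_solveCirc_le _ _ _ _ _
    have hn := N.n_poly
    have hb := N.nb_poly
    have hK := N.K_poly
    have hm := A.coins_poly
    have hl := A.auxLen_poly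
    have h1 := A.commit_poly
    have h2 := A.respond_poly
    repeat' first
      | exact PolyBounded.const _
      | assumption
      | apply PolyBounded.add
      | apply PolyBounded.mul

/-- The comparison is made for each group seed separately. Run on the same tape, the reduction wins
whenever the adversary cheats, and `uniform_units_le` passes from nonzero exponents to all of them.
-/
theorem cheatProb_le (S : GroupGen) {N : Sizes} (A : ProverAdversary N)
    (I : ∀ κ, Finset (Fin (N.K κ))) (aux : ∀ κ, Fin (A.auxLen κ) → Bool)
    (x : ∀ κ, Fin (N.n κ) → ZMod (S.q κ)) (sh : ∀ κ, Fin (N.K κ) → Fin (N.n κ) → ZMod (S.q κ))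
    (hsh : ∀ κ i, ∑ k, sh κ k i = x κ i) (κ : ℕ) :
    cheatProb S A κ (I κ) (aux κ) (x κ) (sh κ) ≤
      dlAdv S (A.reduction I aux (fun κ => legal (x κ)) fun κ k i => ((sh κ k i).val : ℤ)) κ := by
  -- Circuit constants are integers, so the shares are wired in through their representatives.
  have hcast : (fun k i => (((sh κ k i).val : ℤ) : ZMod (S.q κ))) = sh κ := by
    funext k i
    simp
  rw [cheatProb, attackExp, dlAdv, dlGame, GroupGen.setup, PMF.bind_bind, PMF.map_bind,
    PMF.bind_apply, PMF.bind_apply]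
  refine ENNReal.tsum_le_tsum fun ω => mul_le_mul_right ?_ _
  rw [PMF.bind_map, PMF.map_bind]
  simp only [Function.comp_def, PMF.map_comp]
  have hun := preservesUniform_unpackTape (q := S.q κ) (n := N.n κ) (nb := N.nb κ) (K := N.K κ)
    (m := A.coins κ)
  simp only [← hun.map_comp]
  rw [← uniform_map_prod fun u : (ZMod (S.q κ))ˣ × _ =>
    (attackOutcome (S.gp (κ := κ) (ω, u.1)) (S.h (κ := κ) (ω, u.1)) (A.alg κ) (I κ) (aux κ) (x κ)
      (sh κ) (unpackTape u.2)).accept &&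
    decide ((attackOutcome (S.gp (κ := κ) (ω, u.1)) (S.h (κ := κ) (ω, u.1)) (A.alg κ) (I κ) (aux κ)
      (x κ) (sh κ) (unpackTape u.2)).y ≠
      (attackOutcome (S.gp (κ := κ) (ω, u.1)) (S.h (κ := κ) (ω, u.1)) (A.alg κ) (I κ) (aux κ) (x κ)
        (sh κ) (unpackTape u.2)).ideal)]
  have hsh' : ∀ i, ∑ k, ((((sh κ k i).val : ℤ)) : ZMod (S.q κ)) = x κ i := by
    simpa using hsh κ
  refine uniform_units_le _ _ ?_ ?_
  · intro t
    rw [decide_eq_true_eq]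
    exact ProverAttack.eval_solveCirc (A.alg κ) (I κ) (aux κ) (S.grp κ ω) (x κ) _ 0 t hsh'
      (Or.inl rfl)
  · intro z t hz
    rw [Bool.and_eq_true, decide_eq_true_eq] at hz
    rw [decide_eq_true_eq]
    refine ProverAttack.eval_solveCirc (A.alg κ) (I κ) (aux κ) (S.grp κ ω) (x κ) _ z t hsh'
      (Or.inr ?_)
    rw [hcast]
    exact hz

theorem negligible_cheatProb (S : GroupGen) {N : Sizes} (A : ProverAdversary N)
    (I : ∀ κ, Finset (Fin (N.K κ))) (aux : ∀ κ, Fin (A.auxLen κ) → Bool)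
    (x : ∀ κ, Fin (N.n κ) → ZMod (S.q κ)) (sh : ∀ κ, Fin (N.K κ) → Fin (N.n κ) → ZMod (S.q κ))
    (hsh : ∀ κ i, ∑ k, sh κ k i = x κ i) (hDL : DLHard S) :
    Negligible fun κ => (cheatProb S A κ (I κ) (aux κ) (x κ) (sh κ)).toReal := by
  refine Asymptotics.SuperpolynomialDecay.trans_abs_le (hDL (A.reduction I aux
    (fun κ => legal (x κ)) fun κ k i => ((sh κ k i).val : ℤ))) fun κ => ?_
  rw [abs_of_nonneg ENNReal.toReal_nonneg, abs_of_nonneg ENNReal.toReal_nonneg]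
  exact ENNReal.toReal_mono (PMF.apply_ne_top _ _) (cheatProb_le S A I aux x sh hsh κ)

/-! ### The simulator -/

/-- Names for the random bits and field elements of the simulator. -/
abbrev SimIdx (nb K : ℕ) : Type := (Fin K × Fin nb) ⊕ Fin K

/-- The number of coins of the simulator. -/
abbrev simCount (nb K : ℕ) : ℕ := Fintype.card (SimIdx nb K)

theorem simCount_eq (nb K : ℕ) : simCount nb K = K * nb + K := by
  simp [simCount]

/-- The position of a coin on the tape of the simulator. -/
noncomputable def simPos {nb K : ℕ} (c : SimIdx nb K) : Fin (simCount nb K) := Fintype.equivFin _ c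

/-- The randomness of the simulator: public bits, randomness of commitments, final messages. -/
noncomputable def unpackSim {q nb K : ℕ}
    (t : (Fin (simCount nb K) → Bool) × (Fin (simCount nb K) → ZMod q)) :
    (Fin K → Fin nb → Bool) × (Fin K → Fin nb → ZMod q) × (Fin K → ZMod q) :=
  (fun k j => t.1 (simPos (.inl (k, j))), fun k j => t.2 (simPos (.inl (k, j))),
    fun k => t.2 (simPos (.inr k)))

theorem preservesUniform_unpackSim {q nb K : ℕ} [Fact q.Prime] :
    PreservesUniform (unpackSim (q := q) (nb := nb) (K := K)) := by
  have hinj : Function.Injective (simPos (nb := nb) (K := K)) := (Fintype.equivFin _).injective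
  have hb : PreservesUniform fun (f : Fin (simCount nb K) → Bool) (k : Fin K) (j : Fin nb) =>
      f (simPos (.inl (k, j))) :=
    (preservesUniform_equiv (Equiv.curry (Fin K) (Fin nb) Bool)).comp
      (preservesUniform_precomp (hinj.comp Sum.inl_injective))
  have hf : PreservesUniform fun (f : Fin (simCount nb K) → ZMod q) =>
      ((fun k j => f (simPos (.inl (k, j))), fun k => f (simPos (.inr k))) :
        (Fin K → Fin nb → ZMod q) × (Fin K → ZMod q)) :=
    (preservesUniform_equiv ((Equiv.sumArrowEquivProdArrow (Fin K × Fin nb) (Fin K) (ZMod q)).trans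
      ((Equiv.curry (Fin K) (Fin nb) (ZMod q)).prodCongr (Equiv.refl _)))).comp
        (preservesUniform_precomp hinj)
  exact hb.prodMap hf

/-! ### The simulated messages and their exponents -/

section Functions

variable {q : ℕ} (P : PrimeGroup q) {n nb K m l : ℕ} (A : VerifierAttack n nb K m l)
  (I : Finset (Fin K)) (k₀ : Fin K)

/-- What is received after the start, as a function of the commitments, the public bits and the
final messages of the honest provers. -/
noncomputable def receivedView (start : (Ty.start n K m l).El P)
    (c' : Fin K → Fin nb → P.carrier) (b : Fin K → Fin nb → Bool) (resp : Fin K → ZMod q × ZMod q) :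
    (Ty.received nb K).El P :=
  let st := A.submit.eval P (start, c')
  let ans := fun k j => if k ∈ I then false else open Classical in decide (st k j = c' k j)
  let go := A.proceed.eval P ((start, c'), ans)
  (c', ans, fun k j => if k ∈ I ∨ go k = true then b k j else false,
    fun k => if k ∉ I ∧ go k = true then resp k else (0, 0))

/-- The simulated first components of the final messages: uniform subject to their sum. -/
def simValue (e : Fin K → ZMod q) (y : ZMod q) (Δ : Fin K → ZMod q) (k : Fin K) : ZMod q :=
  if k ∈ I then 0 else if k = k₀ then
    y - ∑ k', (if k' ∈ I then Δ k' else 0) - ∑ k', (if k' ∈ I ∨ k' = k₀ then 0 else e k')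
  else e k

/-- The simulated commitments of the honest provers, programmed so that the final check holds. -/
noncomputable def simCom (start : (Ty.start n K m l).El P) (Y : Fin K → ZMod q)
    (b : Fin K → Fin nb → Bool) (w : Fin K → Fin nb → ZMod q) (k : Fin K) (j : Fin nb) :
    P.carrier :=
  if k ∈ I then 1 else
    P.gen ^ (bitVal (b k j) : ZMod q).val *
      (if j.val = 0 then com P start.2.2.1 (Y k) (w k j) *
          ∏ i, start.2.2.2.2.1 k i ^ (0 - bitVal (start.2.2.2.2.2 i) : ZMod q).val
        else com P start.2.2.1 0 (w k j)) ^ (1 - ((2 : ℤ) : ZMod q) * bitVal (b k j)).val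

/-- After the flip by b, which is undone by the exponent 1 - 2b and the factor g^b, the commitments
have exponents a·w, except that the first one also carries Y_k minus the exponents of the valid
client commitments. In the final check the latter cancel and Com(Y_k, ∑ w) is left. -/
theorem simCom_exp [Fact q.Prime] (a : ZMod q) (γ : Fin K → Fin n → ZMod q)
    (start : (Ty.start n K m l).El P) (hh : start.2.2.1 = P.exp a)
    (hγ : ∀ k i, start.2.2.2.2.1 k i = P.exp (γ k i)) (Y : Fin K → ZMod q)
    (b : Fin K → Fin nb → Bool) (w : Fin K → Fin nb → ZMod q) (k : Fin K) (hk : k ∉ I)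
    (j : Fin nb) :
    simCom P I start Y b w k j = P.exp (if b k j = true
      then 1 - ((if j.val = 0 then Y k - ∑ i with start.2.2.2.2.2 i = true, γ k i else 0) + a * w k j)
      else (if j.val = 0 then Y k - ∑ i with start.2.2.2.2.2 i = true, γ k i else 0) + a * w k j) := by
  have h1 : ∏ i, start.2.2.2.2.1 k i ^ (0 - bitVal (start.2.2.2.2.2 i) : ZMod q).val =
      P.exp (- ∑ i with start.2.2.2.2.2 i = true, γ k i) := by
    rw [Finset.sum_filter, ← Finset.sum_neg_distrib, P.exp_sum]
    refine Finset.prod_congr rfl fun i _ => ?_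
    rw [hγ, ← P.exp_mul]
    cases start.2.2.2.2.2 i <;> simp [bitVal]
  have h2 : (if j.val = 0 then com P start.2.2.1 (Y k) (w k j) *
          ∏ i, start.2.2.2.2.1 k i ^ (0 - bitVal (start.2.2.2.2.2 i) : ZMod q).val
        else com P start.2.2.1 0 (w k j)) =
      P.exp ((if j.val = 0 then Y k - ∑ i with start.2.2.2.2.2 i = true, γ k i else 0) +
        a * w k j) := by
    rw [h1, hh]
    split_ifs
    · rw [P.com_eq_exp, ← P.exp_add]
      congr 1
      ring
    · rw [P.com_eq_exp]
  rw [simCom, if_neg hk, h2, ← P.exp_mul]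
  change P.exp _ * _ = _
  rw [← P.exp_add]
  congr 1
  cases b k j
  · simp [bitVal]
  · simp only [bitVal, if_true]
    push_cast
    ring

end Functions

/-! ### The simulator as a circuit -/

namespace VerifierAttack

variable {n nb K m l : ℕ} (A : VerifierAttack n nb K m l) (I : Finset (Fin K)) (k₀ : Fin K)

/-- What the simulator knows when it produces its output. -/
@[reducible] def SimInput (n nb K m l : ℕ) : Ty :=
  .prod (.prod (.tape (simCount nb K)) (.start n K m l)) (.prod .fld (.pow .fld K))

variable {a : Ty} (inp : Circ a (SimInput n nb K m l))

noncomputable def simBit (k : Fin K) (j : Fin nb) : Circ a .bit :=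
  inp.left.left.left.entry (simPos (.inl (k, j)))

noncomputable def simFld (c : SimIdx nb K) : Circ a .fld := inp.left.left.right.entry (simPos c)

/-- The circuit for `simValue`. -/
noncomputable def valueCirc (k : Fin K) : Circ a .fld :=
  if k ∈ I then .fconst _ 0 else if k = k₀ then
    (inp.right.left.sub (.sum fun k' => if k' ∈ I then inp.right.right.entry k' else .fconst _ 0)).sub
      (.sum fun k' => if k' ∈ I ∨ k' = k₀ then .fconst _ 0 else simFld inp (.inr k'))
  else simFld inp (.inr k)

/-- The circuit for `simCom`. -/
noncomputable def comCirc (Y : Circ a (.pow .fld K)) (k : Fin K) (j : Fin nb) : Circ a .grp :=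
  if k ∈ I then (Circ.ggen _).power (.fconst _ 0) else
    ((Circ.ggen _).power (simBit inp k j).ofBit).times
      ((if j.val = 0 then
        (Circ.commit inp.left.right.right.right.left (Y.entry k) (simFld inp (.inl (k, j)))).times
          (.product fun i => (inp.left.right.right.right.right.right.left.entry₂ k i).power
            ((Circ.fconst _ 0).sub (inp.left.right.right.right.right.right.right.entry i).ofBit))
        else Circ.commit inp.left.right.right.right.left (.fconst _ 0)
          (simFld inp (.inl (k, j)))).power
        ((Circ.fconst _ 1).sub ((Circ.fconst _ 2).mul (simBit inp k j).ofBit)))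

/-- The answers of the bit proof oracle. -/
def answerCirc (st c' : Circ a (.pow (.pow .grp nb) K)) (k : Fin K) (j : Fin nb) : Circ a .bit :=
  if k ∈ I then .bconst _ false else (st.entry₂ k j).eqG (c'.entry₂ k j)

/-- The public bits that are revealed. -/
noncomputable def coinCirc (go : Circ a (.pow .bit K)) (k : Fin K) (j : Fin nb) : Circ a .bit :=
  if k ∈ I then simBit inp k j else (go.entry k).and (simBit inp k j)

/-- The final messages that are revealed. -/
noncomputable def messageCirc (Y : Circ a (.pow .fld K)) (go : Circ a (.pow .bit K)) (k : Fin K) :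
    Circ a (.prod .fld .fld) :=
  if k ∈ I then .pair (.fconst _ 0) (.fconst _ 0) else
    .pair ((go.entry k).ofBit.mul (Y.entry k))
      ((go.entry k).ofBit.mul (.sum fun j => simFld inp (.inl (k, j))))

/-- The values that the simulator computes one after the other: the first components of the final
messages, the commitments, those submitted to the bit proof oracle, its answers, and the honest
provers with which the adversary goes on. -/
@[reducible] def SimState (n nb K m l : ℕ) : Ty :=
  .prod (.prod (.prod (.prod (.prod (SimInput n nb K m l) (.pow .fld K)) (.pow (.pow .grp nb) K))
    (.pow (.pow .grp nb) K)) (.pow (.pow .bit nb) K)) (.pow .bit K)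

/-- What is received, once all values are computed. -/
noncomputable def outputCirc : Circ (SimState n nb K m l) (.received nb K) :=
  .pair (Circ.id _).left.left.left.right (.pair (Circ.id _).left.right
    (.pair (.tup fun k => .tup fun j => coinCirc I (Circ.id _).left.left.left.left.left
        (Circ.id _).right k j)
      (.tup (messageCirc I (Circ.id _).left.left.left.left.left
        (Circ.id _).left.left.left.left.right (Circ.id _).right))))

/-- The output circuit of the simulator. -/
noncomputable def simCirc : Circ (SimInput n nb K m l) (.received nb K) :=
  (Circ.tup (valueCirc I k₀ (.id _))).letIn <|
  (Circ.tup fun k => .tup fun j => comCirc I (Circ.id _).left (Circ.id _).right k j).letIn <|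
  (Circ.comp (.pair (Circ.id _).left.left.left.right (Circ.id _).right) A.submit).letIn <|
  (Circ.tup fun k => .tup fun j =>
    answerCirc I (Circ.id _).right (Circ.id _).left.right k j).letIn <|
  (Circ.comp (.pair (.pair (Circ.id _).left.left.left.left.left.right (Circ.id _).left.left.right)
    (Circ.id _).right) A.proceed).letIn (outputCirc I)

section Eval

variable {q : ℕ} (P : PrimeGroup q)

theorem eval_simCirc (t : (Fin (simCount nb K) → Bool) × (Fin (simCount nb K) → ZMod q))
    (start : (Ty.start n K m l).El P) (y : ZMod q) (Δ : Fin K → ZMod q) :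
    (simCirc A I k₀).eval P ((t, start), y, Δ) =
      receivedView P A I start
        (simCom P I start (simValue I k₀ (unpackSim t).2.2 y Δ) (unpackSim t).1 (unpackSim t).2.1)
        (unpackSim t).1
        fun k => (simValue I k₀ (unpackSim t).2.2 y Δ k, ∑ j, (unpackSim t).2.1 k j) := by
  have hY : (Circ.tup (valueCirc I k₀ (.id (SimInput n nb K m l)))).eval P ((t, start), y, Δ) =
      simValue I k₀ (unpackSim t).2.2 y Δ := by
    funext k
    rw [Circ.eval_tup]
    dsimp only
    rw [valueCirc, simValue]
    split_ifs
    · simp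
    · rw [Circ.eval_sub, Circ.eval_sub, Circ.eval_sum, Circ.eval_sum]
      refine congrArg₂ _ (congrArg₂ _ rfl (Finset.sum_congr rfl fun k' _ => ?_))
        (Finset.sum_congr rfl fun k' _ => ?_)
      · split_ifs <;> simp
      · split_ifs
        · simp
        · rfl
    · rfl
  set Y := simValue I k₀ (unpackSim t).2.2 y Δ
  have hC : (Circ.tup fun k => Circ.tup fun j => comCirc I
      (Circ.id (.prod (SimInput n nb K m l) (.pow .fld K))).left (Circ.id _).right k j).eval P
        (((t, start), y, Δ), Y) = simCom P I start Y (unpackSim t).1 (unpackSim t).2.1 := by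
    funext k j
    rw [Circ.eval_tup]
    dsimp only
    rw [Circ.eval_tup]
    dsimp only
    rw [comCirc, simCom]
    split_ifs
    · simp
    · rw [Circ.eval_times, Circ.eval_power, Circ.eval_power, Circ.eval_times, Circ.eval_product]
      simp only [Circ.eval_power, Circ.eval_sub, Circ.eval_fconst, Int.cast_zero, Int.cast_one]
      rfl
    · rw [Circ.eval_times, Circ.eval_power, Circ.eval_power]
      simp only [Circ.eval_commit, Circ.eval_sub, Circ.eval_fconst, Int.cast_zero, Int.cast_one]
      rfl
  set C := simCom P I start Y (unpackSim t).1 (unpackSim t).2.1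
  set st := A.submit.eval P (start, C)
  have hA : (Circ.tup fun k => Circ.tup fun j => answerCirc I
      (Circ.id (.prod (.prod (.prod (SimInput n nb K m l) (.pow .fld K)) (.pow (.pow .grp nb) K))
        (.pow (.pow .grp nb) K))).right (Circ.id _).left.right k j).eval P
        (((((t, start), y, Δ), Y), C), st) =
      fun k j => if k ∈ I then false else open Classical in decide (st k j = C k j) := by
    funext k j
    rw [Circ.eval_tup]
    dsimp only
    rw [Circ.eval_tup]
    dsimp only
    rw [answerCirc]
    split_ifs
    · rfl
    · rfl
  simp only [simCirc, Circ.eval_letIn, hY, hC]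
  set ans : Fin K → Fin nb → Bool :=
    fun k j => if k ∈ I then false else open Classical in decide (st k j = C k j) with hans
  set go := A.proceed.eval P ((start, C), ans)
  refine Eq.trans (congrArg (fun v : Fin K → Fin nb → Bool => (outputCirc I).eval P
    ((((((( t, start), y, Δ), Y), C), st), v), A.proceed.eval P ((start, C), v))) hA) ?_
  refine Prod.ext rfl (Prod.ext rfl (Prod.ext ?_ ?_))
  · funext k j
    change (coinCirc I _ _ k j).eval P _ = if k ∈ I ∨ go k = true then _ else _
    rw [coinCirc]
    by_cases hk : k ∈ I
    · rw [if_pos hk, if_pos (Or.inl hk)]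
      rfl
    · rw [if_neg hk, Circ.eval_and]
      change (go k && _) = _
      cases hg : go k
      · simp [hk]
      · simp only [Bool.true_and, or_true, if_true]
        rfl
  · funext k
    change (messageCirc I _ _ _ k).eval P _ = if k ∉ I ∧ go k = true then _ else _
    rw [messageCirc]
    by_cases hk : k ∈ I
    · rw [if_pos hk, if_neg (fun h => h.1 hk)]
      simp
    · rw [if_neg hk, Circ.eval_pair, Circ.eval_mul, Circ.eval_mul, Circ.eval_sum]
      change ((bitVal (go k) : ZMod q) * Y k, (bitVal (go k) : ZMod q) * ∑ j, _) = _
      cases hg : go k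
      · simp [bitVal]
      · simp only [hk, bitVal, not_false_eq_true, and_self, if_true, one_mul]
        rfl

end Eval

theorem size_valueCirc_le (s : ℕ) (hs : inp.size ≤ s) (k : Fin K) :
    (valueCirc I k₀ inp k).size ≤ 2 * (K * (s + 6) + 1) + s + 14 := by
  have h1 : _ ≤ K * (s + 6) + 1 := Circ.size_sum_le (f := fun k' => if k' ∈ I then inp.right.right.entry k' else
    .fconst _ 0) (s + 4) fun k' => by
    split_ifs
    all_goals simp
    all_goals omega
  have h2 : _ ≤ K * (s + 6) + 1 := Circ.size_sum_le (f := fun k' => if k' ∈ I ∨ k' = k₀ then .fconst _ 0 else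
    simFld inp (.inr k')) (s + 4) fun k' => by
    split_ifs
    all_goals simp [simFld]
    all_goals omega
  unfold valueCirc
  split_ifs
  · simp only [Circ.size_fconst]
    omega
  · simp only [Circ.size_sub, Circ.size_left, Circ.size_right]
    omega
  · simp only [simFld, Circ.size_entry, Circ.size_left, Circ.size_right]
    omega

theorem size_comCirc_le (Y : Circ a (.pow .fld K)) (s : ℕ) (hs : inp.size ≤ s) (hY : Y.size ≤ s)
    (k : Fin K) (j : Fin nb) :
    (comCirc I inp Y k j).size ≤ n * (2 * s + 28) + 5 * s + 70 := by
  have h1 : _ ≤ n * (2 * s + 28) + 4 := Circ.size_product_le (f := fun i =>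
    (inp.left.right.right.right.right.right.left.entry₂ k i).power
      ((Circ.fconst _ 0).sub (inp.left.right.right.right.right.right.right.entry i).ofBit))
    (2 * s + 26) fun i => by simp; omega
  unfold comCirc
  split_ifs
  · simp only [Circ.size_power, Circ.size_ggen, Circ.size_fconst]
    omega
  all_goals
    simp only [Circ.size_power, Circ.size_ggen, Circ.size_fconst, Circ.size_times, Circ.size_ofBit,
      Circ.size_commit, Circ.size_sub, Circ.size_mul, Circ.size_left, Circ.size_right,
      Circ.size_entry, simBit, simFld] at h1 ⊢
    omega

theorem size_answerCirc_le (st c' : Circ a (.pow (.pow .grp nb) K)) (s : ℕ) (h1 : st.size ≤ s)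
    (h2 : c'.size ≤ s) (k : Fin K) (j : Fin nb) :
    (answerCirc I st c' k j).size ≤ 2 * s + 6 := by
  unfold answerCirc
  split_ifs
  · simp
  · simp only [Circ.size_eqG, Circ.size_entry₂]
    omega

theorem size_coinCirc_le (go : Circ a (.pow .bit K)) (s : ℕ) (h1 : inp.size ≤ s) (h2 : go.size ≤ s)
    (k : Fin K) (j : Fin nb) : (coinCirc I inp go k j).size ≤ 2 * s + 7 := by
  unfold coinCirc
  split_ifs <;> simp only [simBit, Circ.size_and, Circ.size_entry, Circ.size_left] <;> omega

theorem size_messageCirc_le (Y : Circ a (.pow .fld K)) (go : Circ a (.pow .bit K)) (s : ℕ)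
    (h1 : inp.size ≤ s) (h2 : go.size ≤ s) (h3 : Y.size ≤ s) (k : Fin K) :
    (messageCirc I inp Y go k).size ≤ nb * (s + 6) + 3 * s + 20 := by
  have h : _ ≤ nb * (s + 6) + 1 := Circ.size_sum_le (f := fun j => simFld inp (.inl (k, j))) (s + 4) fun j => by
    simp [simFld]
    omega
  unfold messageCirc
  split_ifs
  · simp only [Circ.size_pair, Circ.size_fconst]
    omega
  · simp only [Circ.size_pair, Circ.size_mul, Circ.size_ofBit, Circ.size_entry]
    omega

theorem size_simCirc_le :
    (simCirc A I k₀).size ≤ (K * (2 * (K * 7 + 1) + 1 + 14) + 1) +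
      (K * (nb * (n * 32 + 10 + 70) + 1) + 1) + A.submit.size + (K * (nb * 12 + 1) + 1) +
      A.proceed.size + (K * (nb * 19 + 1) + 1) + (K * (nb * 12 + 18 + 20) + 1) + 60 := by
  have h1 := Circ.size_tup_le _ (size_valueCirc_le I k₀ (.id (SimInput n nb K m l)) 1 (by simp))
  have h2 := Circ.size_tup_tup_le _ (size_comCirc_le I
    (Circ.id (.prod (SimInput n nb K m l) (.pow .fld K))).left (Circ.id _).right 2 (by simp)
      (by simp))
  have h3 := Circ.size_tup_tup_le _ (size_answerCirc_le I
    (Circ.id (.prod (.prod (.prod (SimInput n nb K m l) (.pow .fld K)) (.pow (.pow .grp nb) K))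
        (.pow (.pow .grp nb) K))).right (Circ.id _).left.right 3 (by simp) (by simp))
  have h4 := Circ.size_tup_tup_le _ (size_coinCirc_le I
    (Circ.id (.prod (.prod (.prod (.prod (.prod (SimInput n nb K m l) (.pow .fld K))
      (.pow (.pow .grp nb) K)) (.pow (.pow .grp nb) K)) (.pow (.pow .bit nb) K))
        (.pow .bit K))).left.left.left.left.left
    (Circ.id _).right 6 (by simp) (by simp))
  have h5 := Circ.size_tup_le _ (size_messageCirc_le I
    (Circ.id (.prod (.prod (.prod (.prod (.prod (SimInput n nb K m l) (.pow .fld K))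
      (.pow (.pow .grp nb) K)) (.pow (.pow .grp nb) K)) (.pow (.pow .bit nb) K))
        (.pow .bit K))).left.left.left.left.left (Circ.id _).left.left.left.left.right
    (Circ.id _).right 6 (by simp) (by simp) (by simp))
  simp only [simCirc, outputCirc, Circ.size_letIn, Circ.size_comp, Circ.size_pair, Circ.size_right,
    Circ.size_left, Circ.size_id]
  simp only [SimInput, SimState, Nat.reduceAdd, Nat.reduceMul] at h1 h2 h3 h4 h5 ⊢
  omega

/-- The simulator for one value of the security parameter. -/
noncomputable def simulation : Simulation n nb K m l (simCount nb K) where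
  -- With inputs 0 for the corrupted provers, y minus their noise is the total of the honest
  -- provers' messages.
  input := .tup fun _ => .fconst _ 0
  output := simCirc A I k₀

end VerifierAttack

/-! ### Perfect simulation -/

section Simulation

variable {q : ℕ} [Fact q.Prime]

theorem sum_additiveShares {n K : ℕ} (hK : 0 < K) (x : Fin n → ZMod q) (t : Fin K → Fin n → ZMod q)
    (i : Fin n) : ∑ k, additiveShares x t k i = x i := by
  obtain ⟨K, rfl⟩ : ∃ K', K = K' + 1 := ⟨K - 1, by omega⟩
  simp only [additiveShares, Finset.sum_filter]
  rw [Fin.sum_univ_succ, Fin.sum_univ_succ]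
  simp

/-- The share of the first prover changes by minus the sum of the other shifts, which equals its own
shift because the total is 0. -/
theorem additiveShares_add {n K : ℕ} (x : Fin n → ZMod q) (t d : Fin K → Fin n → ZMod q)
    (hd : ∀ i, ∑ k, d k i = 0) (k : Fin K) (i : Fin n) :
    additiveShares x (fun k i => t k i + d k i) k i = additiveShares x t k i + d k i := by
  obtain ⟨K, rfl⟩ : ∃ K', K = K' + 1 := ⟨K - 1, by have := k.2; omega⟩
  have h := hd i
  rw [Fin.sum_univ_succ] at h
  simp only [additiveShares]
  split_ifs with hk
  · obtain rfl : k = 0 := Fin.ext hk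
    simp only [Finset.sum_filter]
    rw [Fin.sum_univ_succ, Fin.sum_univ_succ]
    simp only [Fin.val_zero, ne_eq, not_true_eq_false, if_false, Fin.val_succ, Nat.succ_ne_zero,
      not_false_eq_true, if_true, Finset.sum_add_distrib]
    linear_combination -h
  · rfl

variable (P : PrimeGroup q) {n nb K m l : ℕ} (A : VerifierAttack n nb K m l) (I : Finset (Fin K))
  (aux : Fin l → Bool) (x : Fin n → ZMod q)

/-- An honest prover offers a bit opening of its own commitment, so the oracle accepts a substituted
commitment exactly when it equals the original. The answers thus need no secret and can be
simulated. -/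
theorem realJoint_eq (h : P.carrier) (sh : Fin K → Fin n → ZMod q)
    (w : ((Fin m → Bool) × (Fin m → ZMod q)) × PartyRand q n nb K) :
    realJoint P h A I aux x sh w =
      ((startView P h I aux x sh w.2.1 w.1,
        receivedView P A I (startView P h I aux x sh w.2.1 w.1) (honestComs P h I w.2.2.1 w.2.2.2.1)
          w.2.2.2.2 (honestResponse P h x sh w)),
        fun k => if k ∈ I then 0 else ∑ j, bitVal (xor (w.2.2.1 k j) (w.2.2.2.2 k j))) := by
  have hans : (fun k j => if k ∈ I then false else orOracle P h
      (A.submit.eval P (startView P h I aux x sh w.2.1 w.1,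
        honestComs P h I w.2.2.1 w.2.2.2.1) k j) (bitVal (w.2.2.1 k j)) (w.2.2.2.1 k j)) =
      fun k j => if k ∈ I then false else open Classical in decide
        (A.submit.eval P (startView P h I aux x sh w.2.1 w.1,
          honestComs P h I w.2.2.1 w.2.2.2.1) k j = honestComs P h I w.2.2.1 w.2.2.2.1 k j) := by
    funext k j
    split_ifs with hk
    · rfl
    · have hc : honestComs P h I w.2.2.1 w.2.2.2.1 k j =
          com P h (bitVal (w.2.2.1 k j)) (w.2.2.2.1 k j) := if_neg hk
      rw [Bool.eq_iff_iff]
      simp only [orOracle, decide_eq_true_eq, hc, bitVal_eq, true_and]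
  simp only [realJoint, receivedView]
  rw [hans]
  rfl

theorem receivedView_congr {q : ℕ} (P : PrimeGroup q) (A : VerifierAttack n nb K m l)
    (I : Finset (Fin K)) (start : (Ty.start n K m l).El P) (c' : Fin K → Fin nb → P.carrier)
    (b : Fin K → Fin nb → Bool) {resp resp' : Fin K → ZMod q × ZMod q}
    (h : ∀ k, k ∉ I → resp k = resp' k) :
    receivedView P A I start c' b resp = receivedView P A I start c' b resp' := by
  refine Prod.ext rfl (Prod.ext rfl (Prod.ext rfl ?_))
  funext k
  simp only [receivedView]
  split_ifs with hk
  · exact h k hk.1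
  · rfl

/-! ### Change of variables between real and simulated randomness -/

section Shift

variable (a : ZMod q) (k₀ : Fin K) (ind : Fin n → ZMod q)

/-- The randomness of the real experiment, together with one element of `ℤ_q` for every prover. -/
abbrev JointRand (q n nb K m : ℕ) : Type :=
  ((Fin K → Fin n → ZMod q) × (((Fin m → Bool) × (Fin m → ZMod q)) × PartyRand q n nb K)) ×
    (Fin K → ZMod q)

/-- The sum of the shares and of the noise of a prover. -/
def partialCount (t : Fin K → Fin n → ZMod q) (u : Fin K → Fin nb → Bool) (k : Fin K) : ZMod q :=
  ∑ i ∈ legal x, additiveShares x t k i + ∑ j, bitVal (u k j)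

/-- The shift of the honest shares that turns partial counts into simulated values. -/
def shareShift (t : Fin K → Fin n → ZMod q) (u : Fin K → Fin nb → Bool) (e : Fin K → ZMod q)
    (k : Fin K) : ZMod q :=
  if k ∈ I then 0 else if k = k₀ then
    - ∑ k', (if k' ∈ I ∨ k' = k₀ then 0 else e k' - partialCount x t u k')
  else e k - partialCount x t u k

theorem sum_shareShift (hk₀ : k₀ ∉ I) (t : Fin K → Fin n → ZMod q) (u : Fin K → Fin nb → Bool)
    (e : Fin K → ZMod q) : ∑ k, shareShift I x k₀ t u e k = 0 := by
  rw [← Finset.add_sum_erase _ _ (Finset.mem_univ k₀)]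
  have h0 : shareShift I x k₀ t u e k₀ =
      - ∑ k', (if k' ∈ I ∨ k' = k₀ then 0 else e k' - partialCount x t u k') := by
    rw [shareShift, if_neg hk₀, if_pos rfl]
  rw [h0, ← Finset.add_sum_erase (a := k₀) Finset.univ
    (fun k' => if k' ∈ I ∨ k' = k₀ then 0 else e k' - partialCount x t u k') (Finset.mem_univ k₀),
    if_pos (Or.inr rfl), zero_add, neg_add_eq_zero]
  refine Finset.sum_congr rfl fun k hk => ?_
  have hk1 := Finset.ne_of_mem_erase hk
  simp [shareShift, hk1]

/-- The simulated value of a prover, from the randomness of the simulated experiment. -/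
def jointValue (t : Fin K → Fin n → ZMod q) (u : Fin K → Fin nb → Bool) (e : Fin K → ZMod q) :
    Fin K → ZMod q :=
  simValue I k₀ e (∑ k, ((if k ∈ I then 0 else ∑ i ∈ legal x, additiveShares x t k i) +
    ∑ j, bitVal (u k j))) fun k => if k ∈ I then ∑ j, bitVal (u k j) else 0

/-- For k ≠ k₀ the shift is defined as the difference of the two sides. For k₀ both sides are what
is left of the honest total, since the shifts sum to 0. -/
theorem jointValue_eq (hk₀ : k₀ ∉ I) (t : Fin K → Fin n → ZMod q) (u : Fin K → Fin nb → Bool)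
    (e : Fin K → ZMod q) (k : Fin K) (hk : k ∉ I) :
    jointValue I x k₀ t u e k = partialCount x t u k + shareShift I x k₀ t u e k := by
  rw [jointValue, simValue, shareShift, if_neg hk, if_neg hk]
  split_ifs with hkk
  · have h1 : ∀ k', (((if k' ∈ I then 0 else ∑ i ∈ legal x, additiveShares x t k' i) +
        ∑ j, bitVal (u k' j)) - (if k' ∈ I then ∑ j, bitVal (u k' j) else 0) -
        (if k' ∈ I ∨ k' = k₀ then 0 else e k') : ZMod q) =
        (if k' = k₀ then partialCount x t u k₀ else 0) -
          (if k' ∈ I ∨ k' = k₀ then 0 else e k' - partialCount x t u k') := by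
      intro k'
      by_cases h : k' = k₀
      · subst h
        simp [hk₀, partialCount]
      · by_cases h' : k' ∈ I
        · simp [h, h']
        · simp [h, h', partialCount]
    rw [← Finset.sum_sub_distrib, ← Finset.sum_sub_distrib, Finset.sum_congr rfl fun k' _ => h1 k',
      Finset.sum_sub_distrib, Finset.sum_ite_eq', if_pos (Finset.mem_univ _), hkk, sub_eq_add_neg]
  · ring

/-- The randomness of the real experiment that leads to the view which the simulator produces
from the randomness `ω`. -/
def realRand (ω : JointRand q n nb K m) : JointRand q n nb K m :=
  let t := ω.1.1
  let r := ω.1.2.2.1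
  let u := ω.1.2.2.2.1
  let w := ω.1.2.2.2.2.1
  let b := ω.1.2.2.2.2.2
  let e := ω.2
  let δ := shareShift I x k₀ t u e
  let Y := fun k => partialCount x t u k + δ k
  -- The shift of a share by ind i · δ k is offset in r by a⁻¹ times as much, which fixes the client
  -- commitments. The formula for s solves v + a·s = (exponent of the simulated commitment) with v =
  -- u ⊕ b. Storing e - δ in the spare component keeps the old partial counts and makes the map
  -- invertible.
  ((fun k i => t k i + ind i * δ k,
    (ω.1.2.1, fun k i => r k i - a⁻¹ * (ind i * δ k), fun k j => xor (u k j) (b k j),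
      fun k j => (if b k j = true then -1 else 1) * (w k j + a⁻¹ * ((if j.val = 0 then
        Y k - ∑ i ∈ legal x, (additiveShares x t k i + a * r k i) else 0) - bitVal (u k j))), b)),
    fun k => e k - δ k)

theorem additiveShares_shift (hk₀ : k₀ ∉ I)
    (t : Fin K → Fin n → ZMod q) (u : Fin K → Fin nb → Bool)
    (e : Fin K → ZMod q) (k : Fin K) (i : Fin n) :
    additiveShares x (fun k i => t k i + ind i * shareShift I x k₀ t u e k) k i =
      additiveShares x t k i + ind i * shareShift I x k₀ t u e k :=
  additiveShares_add x t (fun k i => ind i * shareShift I x k₀ t u e k) (fun i => by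
    rw [← Finset.mul_sum, sum_shareShift I x k₀ hk₀, mul_zero]) k i

/-- Either the weights on the legal clients sum to 1, or k₀ is the only honest prover and all shifts
vanish. -/
theorem sum_ind_mul_shareShift
    (hind : ∑ i ∈ legal x, ind i = 1 ∨ ∀ k, k ∉ I → k = k₀)
    (t : Fin K → Fin n → ZMod q) (u : Fin K → Fin nb → Bool)
    (e : Fin K → ZMod q) (k : Fin K) :
    ∑ i ∈ legal x, ind i * shareShift I x k₀ t u e k = shareShift I x k₀ t u e k := by
  rw [← Finset.sum_mul]
  rcases hind with h | h
  · rw [h, one_mul]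
  · have : shareShift I x k₀ t u e k = 0 := by
      unfold shareShift
      split_ifs with h1 h2
      · rfl
      · rw [neg_eq_zero]
        refine Finset.sum_eq_zero fun k' _ => ?_
        rw [if_pos]
        by_cases hk' : k' ∈ I
        · exact Or.inl hk'
        · exact Or.inr (h k' hk')
      · exact absurd (h k h1) h2
    rw [this, mul_zero]

theorem sum_shares_shift (hk₀ : k₀ ∉ I)
    (hind : ∑ i ∈ legal x, ind i = 1 ∨ ∀ k, k ∉ I → k = k₀)
    (t : Fin K → Fin n → ZMod q) (u : Fin K → Fin nb → Bool)
    (e : Fin K → ZMod q) (k : Fin K) :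
    ∑ i ∈ legal x, additiveShares x (fun k i => t k i + ind i * shareShift I x k₀ t u e k) k i =
      ∑ i ∈ legal x, additiveShares x t k i + shareShift I x k₀ t u e k := by
  simp only [additiveShares_shift I x k₀ ind hk₀, Finset.sum_add_distrib,
    sum_ind_mul_shareShift I x k₀ ind hind]

/-- Once the shifts are recovered from the image, each remaining component is a translation, up to a
sign for w. -/
theorem realRand_injective (hk₀ : k₀ ∉ I)
    (hind : ∑ i ∈ legal x, ind i = 1 ∨ ∀ k, k ∉ I → k = k₀) :
    Function.Injective (realRand (nb := nb) (m := m) I x a k₀ ind) := by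
  rintro ⟨⟨t, ρ, r, u, w, b⟩, e⟩ ⟨⟨t', ρ', r', u', w', b'⟩, e'⟩ h
  simp only [realRand, Prod.mk.injEq] at h
  obtain ⟨⟨ht, hρ, hr, hu, hw, hb⟩, he⟩ := h
  subst hb hρ
  obtain rfl : u = u' := by
    funext k j
    simpa using congrFun (congrFun hu k) j
  have hS : ∀ k, ∑ i ∈ legal x, additiveShares x t k i + shareShift I x k₀ t u e k =
      ∑ i ∈ legal x, additiveShares x t' k i + shareShift I x k₀ t' u e' k := by
    intro k
    rw [← sum_shares_shift I x k₀ ind hk₀ hind, ht, sum_shares_shift I x k₀ ind hk₀ hind]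
  -- For these provers the shifted share sum is e minus the noise, and the spare component e - δ is
  -- the partial count; together they determine δ.
  have hp : ∀ k, k ∉ I → k ≠ k₀ → e k = e' k ∧ partialCount x t u k = partialCount x t' u k := by
    intro k hk hkk
    have h1 := hS k
    have h2 := congrFun he k
    simp only [shareShift, if_neg hk, if_neg hkk, partialCount] at h1 h2 ⊢
    exact ⟨by linear_combination h1, by linear_combination h2⟩
  have hδ : shareShift I x k₀ t u e = shareShift I x k₀ t' u e' := by
    funext k
    unfold shareShift
    split_ifs with h1 h2
    · rfl
    · congr 1
      refine Finset.sum_congr rfl fun k' _ => ?_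
      split_ifs with h3
      · rfl
      · rw [not_or] at h3
        rw [(hp k' h3.1 h3.2).1, (hp k' h3.1 h3.2).2]
    · rw [(hp k h1 h2).1, (hp k h1 h2).2]
  rw [hδ] at ht hr he
  obtain rfl : t = t' := by
    funext k i
    exact add_right_cancel (congrFun (congrFun ht k) i)
  obtain rfl : r = r' := by
    funext k i
    exact sub_left_inj.mp (congrFun (congrFun hr k) i)
  obtain rfl : e = e' := by
    funext k
    exact sub_left_inj.mp (congrFun he k)
  obtain rfl : w = w' := by
    funext k j
    have h1 := congrFun (congrFun hw k) j
    have h2 : (if b k j = true then -1 else 1 : ZMod q) ≠ 0 := by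
      split_ifs <;> simp
    exact add_right_cancel (mul_left_cancel₀ h2 h1)
  rfl

/-- The simulated view, jointly with the noise of the honest provers, as a function of the
randomness. -/
noncomputable def simJoint (ω : JointRand q n nb K m) : (Ty.joint n nb K m l).El P :=
  let start := startView P (P.exp a) I aux x (additiveShares x ω.1.1) ω.1.2.2.1 ω.1.2.1
  let Y := jointValue I x k₀ ω.1.1 ω.1.2.2.2.1 ω.2
  ((start, receivedView P A I start (simCom P I start Y ω.1.2.2.2.2.2 ω.1.2.2.2.2.1) ω.1.2.2.2.2.2
    fun k => (Y k, ∑ j, ω.1.2.2.2.2.1 k j)),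
    fun k => if k ∈ I then 0 else ∑ j, bitVal (ω.1.2.2.2.1 k j))

/-- Perfect hiding made explicit: since a is invertible, each simulated commitment has a real
opening to the prescribed bit. It remains to see that start, commitments and final messages agree.
-/
theorem realJoint_realRand (hk₀ : k₀ ∉ I)
    (hind : ∑ i ∈ legal x, ind i = 1 ∨ ∀ k, k ∉ I → k = k₀)
    (hnb : 1 ≤ nb) (ha : a ≠ 0) (ω : JointRand q n nb K m) :
    realJoint P (P.exp a) A I aux x (additiveShares x (realRand I x a k₀ ind ω).1.1)
        (realRand I x a k₀ ind ω).1.2 =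
      simJoint P A I aux x a k₀ ω := by
  obtain ⟨⟨t, ρ, r, u, w, b⟩, e⟩ := ω
  have hK : 0 < K := k₀.pos
  set δ := shareShift I x k₀ t u e with hδ
  set t' : Fin K → Fin n → ZMod q := fun k i => t k i + ind i * δ k with ht'
  set r' : Fin K → Fin n → ZMod q := fun k i => r k i - a⁻¹ * (ind i * δ k) with hr'
  set Γ : Fin K → ZMod q := fun k => ∑ i ∈ legal x, (additiveShares x t k i + a * r k i)
  set Y : Fin K → ZMod q := fun k => partialCount x t u k + δ k with hY
  set v : Fin K → Fin nb → Bool := fun k j => xor (u k j) (b k j) with hv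
  set s : Fin K → Fin nb → ZMod q := fun k j => (if b k j = true then -1 else 1) *
    (w k j + a⁻¹ * ((if j.val = 0 then Y k - Γ k else 0) - bitVal (u k j))) with hs
  have hreal : realRand I x a k₀ ind ((t, ρ, r, u, w, b), e) =
      ((t', ρ, r', v, s, b), fun k => e k - δ k) := rfl
  have hsh : ∀ k i, additiveShares x t' k i = additiveShares x t k i + ind i * δ k :=
    additiveShares_shift I x k₀ ind hk₀ t u e
  -- The client commitments do not notice the shift; this is where a ≠ 0 enters for the start of the
  -- view.
  have hopen : ∀ k i, additiveShares x t' k i + a * r' k i = additiveShares x t k i + a * r k i := by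
    intro k i
    rw [hsh, hr']
    field_simp
    ring
  have hvalid : ∀ (t : Fin K → Fin n → ZMod q) (r : Fin K → Fin n → ZMod q),
      valid P (P.exp a) x (additiveShares x t) r = fun i => decide (x i = 0 ∨ x i = 1) :=
    fun t r => funext fun i => P.valid_eq a x _ _ (sum_additiveShares hK x t) i
  have hstart : startView P (P.exp a) I aux x (additiveShares x t') r' ρ =
      startView P (P.exp a) I aux x (additiveShares x t) r ρ := by
    simp only [startView, hvalid]
    refine Prod.ext rfl (Prod.ext rfl (Prod.ext rfl (Prod.ext ?_ (Prod.ext ?_ rfl))))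
    · funext k i
      dsimp only
      split_ifs with hk
      · have : δ k = 0 := by rw [hδ, shareShift, if_pos hk]
        simp [hsh, hr', this]
      · rfl
    · funext k i
      simp only [P.clientCom_exp, hopen]
  set start := startView P (P.exp a) I aux x (additiveShares x t) r ρ
  have hfilter : (Finset.univ.filter fun i => start.2.2.2.2.2 i = true) = legal x :=
    P.valid_filter a x _ _ (sum_additiveShares hK x t)
  have hcom : honestComs P (P.exp a) I v s =
      simCom P I start (jointValue I x k₀ t u e) b w := by
    funext k j
    by_cases hk : k ∈ I
    · rw [honestComs, simCom, if_pos hk, if_pos hk]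
    · rw [simCom_exp P I a (fun k i => additiveShares x t k i + a * r k i) start rfl
        (fun k i => P.clientCom_exp a _ _ k i) _ _ _ k hk, honestComs, if_neg hk, P.com_eq_exp,
        hfilter, jointValue_eq I x k₀ hk₀ t u e k hk]
      congr 1
      change _ = if b k j = true then 1 - ((if j.val = 0 then Y k - Γ k else 0) + a * w k j) else
        (if j.val = 0 then Y k - Γ k else 0) + a * w k j
      generalize hc : (if j.val = 0 then Y k - Γ k else 0 : ZMod q) = c
      simp only [hv, hs, hc, bitVal_xor]
      split_ifs
      · field_simp
        ring
      · field_simp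
        ring
  have hresp : ∀ k, k ∉ I → honestResponse P (P.exp a) x (additiveShares x t') (ρ, r', v, s, b) k =
      (jointValue I x k₀ t u e k, ∑ j, w k j) := by
    intro k hk
    have hsum := sum_shares_shift I x k₀ ind hk₀ hind t u e k
    have h1 : ∀ j, (if b k j = true then 1 - bitVal (v k j) else bitVal (v k j) : ZMod q) =
        bitVal (u k j) := by
      intro j
      rw [← bitVal_xor]
      simp [hv]
    have h2 : ∀ j, (if b k j = true then - s k j else s k j) =
        w k j + a⁻¹ * ((if j.val = 0 then Y k - Γ k else 0) - bitVal (u k j)) := by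
      intro j
      simp only [hs]
      split_ifs <;> ring
    -- At least one private bit is needed here, to carry the correction that makes the final check
    -- hold.
    have h3 : ∑ j : Fin nb, (if j.val = 0 then Y k - Γ k else 0) = Y k - Γ k := by
      rw [Finset.sum_eq_single (⟨0, hnb⟩ : Fin nb)]
      · simp
      · intro j _ hj
        rw [if_neg]
        intro h0
        exact hj (Fin.ext h0)
      · simp
    -- The total exponent Γ is unchanged, so the new share sum determines the new sum of the r.
    have h4 : ∑ i ∈ legal x, r' k i = a⁻¹ * (Γ k - (∑ i ∈ legal x, additiveShares x t k i + δ k)) := by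
      have h5 : Γ k = ∑ i ∈ legal x, additiveShares x t' k i + a * ∑ i ∈ legal x, r' k i := by
        rw [Finset.mul_sum, ← Finset.sum_add_distrib]
        exact Finset.sum_congr rfl fun i _ => (hopen k i).symm
      rw [h5, hsum]
      field_simp
      ring
    simp only [honestResponse, response, P.valid_filter a x _ _ (sum_additiveShares hK x t'), h1, h2]
    refine Prod.ext ?_ ?_
    · rw [hsum, jointValue_eq I x k₀ hk₀ t u e k hk, partialCount]
      ring
    · simp only [Finset.sum_add_distrib, ← Finset.mul_sum, Finset.sum_sub_distrib, h3, h4]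
      simp only [hY, partialCount]
      ring
  rw [hreal, realJoint_eq]
  dsimp only
  rw [hstart, hcom, receivedView_congr P A I start _ b hresp]
  refine Prod.ext rfl ?_
  funext k
  simp [simJoint, hv]

end Shift

end Simulation

/-- The simulator for the adversary `A`; `k₀ κ` is an honest prover. -/
noncomputable def VerifierAdversary.simulator {N : Sizes} (A : VerifierAdversary N)
    (I : ∀ κ, Finset (Fin (N.K κ))) (k₀ : ∀ κ, Fin (N.K κ)) : Simulator A where
  coins κ := simCount (N.nb κ) (N.K κ)
  alg κ := (A.alg κ).simulation (I κ) (k₀ κ)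
  coins_poly := by
    simp only [simCount_eq]
    exact (N.K_poly.mul N.nb_poly).add N.K_poly
  input_poly := by
    refine PolyBounded.mono ((N.K_poly.mul (PolyBounded.const 1)).add (PolyBounded.const 1))
      fun κ => Circ.size_tup_le 1 fun k => le_of_eq rfl
  output_poly := by
    refine PolyBounded.mono ?_ fun κ => VerifierAttack.size_simCirc_le _ _ _
    have hn := N.n_poly
    have hb := N.nb_poly
    have hK := N.K_poly
    have h1 := A.submit_poly
    have h2 := A.proceed_poly
    repeat' first
      | exact PolyBounded.const _
      | assumption
      | apply PolyBounded.add
      | apply PolyBounded.mul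

/-! ### Equality of the real and simulated ensembles -/

section Ensembles

set_option synthInstance.maxSize 1000
set_option synthInstance.maxHeartbeats 200000

variable {q : ℕ} [Fact q.Prime] (P : PrimeGroup q) {n nb K m l : ℕ}
  (A : VerifierAttack n nb K m l) (I : Finset (Fin K)) (aux : Fin l → Bool) (x : Fin n → ZMod q)
  (a : ZMod q) (k₀ : Fin K)

theorem idealJoint_eq (sh : Fin K → Fin n → ZMod q)
    (w : ((Fin m → Bool) × (Fin m → ZMod q)) ×
      ((Fin (simCount nb K) → Bool) × (Fin (simCount nb K) → ZMod q)) × (Fin K → Fin n → ZMod q)) :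
    idealJoint P (P.exp a) (A.simulation I k₀) I aux x sh w =
      (PMF.uniformOfFintype (Fin K → Fin nb → Bool)).map fun u =>
        ((startView P (P.exp a) I aux x sh w.2.2 w.1,
          (VerifierAttack.simCirc A I k₀).eval P ((w.2.1, startView P (P.exp a) I aux x sh w.2.2 w.1),
            ∑ k, ((if k ∈ I then 0 else ∑ i ∈ legal x, sh k i) + ∑ j, bitVal (u k j)),
            fun k => if k ∈ I then ∑ j, bitVal (u k j) else 0)),
          fun k => if k ∈ I then 0 else ∑ j, bitVal (u k j)) := by
  have hX : (A.simulation I k₀).input.eval P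
      (w.2.1, startView P (P.exp a) I aux x sh w.2.2 w.1) = fun _ => (0 : ZMod q) := by
    funext k
    exact Int.cast_zero
  simp only [idealJoint, mBin_eq, PMF.map_comp, hX]
  rfl

/-- The noise bits of the functionality occupy the place of the private bits, and the simulator's
tape supplies b, w and e. -/
theorem uniform_ideal_eq :
    ((PMF.uniformOfFintype (Fin K → Fin n → ZMod q)).bind fun t =>
      (PMF.uniformOfFintype (((Fin m → Bool) × (Fin m → ZMod q)) ×
        ((Fin (simCount nb K) → Bool) × (Fin (simCount nb K) → ZMod q)) ×
          (Fin K → Fin n → ZMod q))).bind fun w =>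
            idealJoint P (P.exp a) (A.simulation I k₀) I aux x (additiveShares x t) w) =
      (PMF.uniformOfFintype (JointRand q n nb K m)).map (simJoint P A I aux x a k₀) := by
  have hpre : PreservesUniform fun u : ((Fin K → Fin n → ZMod q) ×
      (((Fin m → Bool) × (Fin m → ZMod q)) ×
        ((Fin (simCount nb K) → Bool) × (Fin (simCount nb K) → ZMod q)) ×
          (Fin K → Fin n → ZMod q))) × (Fin K → Fin nb → Bool) =>
      (((u.1.1, u.1.2.1, u.1.2.2.2, u.2, (unpackSim u.1.2.2.1).2.1, (unpackSim u.1.2.2.1).1),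
        (unpackSim u.1.2.2.1).2.2) : JointRand q n nb K m) := by
    have h1 : PreservesUniform fun u : ((Fin K → Fin n → ZMod q) ×
        ((Fin m → Bool) × (Fin m → ZMod q)) × (Fin K → Fin n → ZMod q) × (Fin K → Fin nb → Bool)) ×
          (Fin K → Fin nb → Bool) × (Fin K → Fin nb → ZMod q) × (Fin K → ZMod q) =>
        (((u.1.1, u.1.2.1, u.1.2.2.1, u.1.2.2.2, u.2.2.1, u.2.1), u.2.2.2) :
          JointRand q n nb K m) := by
      apply preservesUniform_of_bijective
      constructor
      · rintro ⟨⟨t, ρ, r, u⟩, b, w, e⟩ ⟨⟨t', ρ', r', u'⟩, b', w', e'⟩ h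
        simp only [Prod.mk.injEq] at h ⊢
        tauto
      · rintro ⟨⟨t, ρ, r, u, w, b⟩, e⟩
        exact ⟨((t, ρ, r, u), b, w, e), rfl⟩
    have h2 : PreservesUniform fun u : ((Fin K → Fin n → ZMod q) ×
      (((Fin m → Bool) × (Fin m → ZMod q)) ×
        ((Fin (simCount nb K) → Bool) × (Fin (simCount nb K) → ZMod q)) ×
          (Fin K → Fin n → ZMod q))) × (Fin K → Fin nb → Bool) =>
        ((u.1.1, u.1.2.1, u.1.2.2.2, u.2), u.1.2.2.1) := by
      apply preservesUniform_of_bijective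
      constructor
      · rintro ⟨⟨t, ρ, c, r⟩, u⟩ ⟨⟨t', ρ', c', r'⟩, u'⟩ h
        simp only [Prod.mk.injEq] at h ⊢
        tauto
      · rintro ⟨⟨t, ρ, r, u⟩, c⟩
        exact ⟨((t, ρ, c, r), u), rfl⟩
    exact h1.comp (((preservesUniform_equiv (Equiv.refl _)).prodMap preservesUniform_unpackSim).comp h2)
  rw [← hpre.map_comp, uniform_map_prod]
  simp only [idealJoint_eq]
  have h3 := uniform_map_prod (α := Fin K → Fin n → ZMod q)
    (β := ((Fin m → Bool) × (Fin m → ZMod q)) ×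
        ((Fin (simCount nb K) → Bool) × (Fin (simCount nb K) → ZMod q)) ×
          (Fin K → Fin n → ZMod q)) fun u => u
  rw [show (fun u => u) = @id ((Fin K → Fin n → ZMod q) × (((Fin m → Bool) × (Fin m → ZMod q)) ×
        ((Fin (simCount nb K) → Bool) × (Fin (simCount nb K) → ZMod q)) ×
          (Fin K → Fin n → ZMod q))) from rfl, PMF.map_id] at h3
  rw [h3]
  simp only [PMF.bind_bind, PMF.bind_map, Function.comp_def]
  refine congrArg _ (funext fun t => congrArg _ (funext fun w => congrArg (fun f => PMF.map f _)
    (funext fun u => Prod.ext (Prod.ext rfl ?_) rfl)))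
  exact VerifierAttack.eval_simCirc A I k₀ P w.2.1 _ _ _

theorem uniform_real_eq (hk₀ : k₀ ∉ I) (hx : (legal x).Nonempty ∨ ∀ k, k ∉ I → k = k₀)
    (hnb : 1 ≤ nb) (ha : a ≠ 0) :
    ((PMF.uniformOfFintype (Fin K → Fin n → ZMod q)).bind fun t =>
      (PMF.uniformOfFintype (((Fin m → Bool) × (Fin m → ZMod q)) × PartyRand q n nb K)).map fun w =>
        realJoint P (P.exp a) A I aux x (additiveShares x t) w) =
      (PMF.uniformOfFintype (JointRand q n nb K m)).map (simJoint P A I aux x a k₀) := by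
  -- One legal client bears the whole shift; with a single honest prover all shifts vanish and any
  -- weights do.
  obtain ⟨ind, hind⟩ : ∃ ind : Fin n → ZMod q,
      ∑ i ∈ legal x, ind i = 1 ∨ ∀ k, k ∉ I → k = k₀ := by
    rcases hx with ⟨i, hi⟩ | h
    · refine ⟨Pi.single i 1, Or.inl ?_⟩
      rw [Finset.sum_pi_single', if_pos hi]
    · exact ⟨0, Or.inr h⟩
  rw [← uniform_map_prod fun u : (Fin K → Fin n → ZMod q) ×
      (((Fin m → Bool) × (Fin m → ZMod q)) × PartyRand q n nb K) =>
        realJoint P (P.exp a) A I aux x (additiveShares x u.1) u.2,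
    -- The real experiment is given one idle field element per prover, to match the randomness e of
    -- the simulator.
    ← (preservesUniform_fst (β := Fin K → ZMod q)).map_comp]
  exact uniform_map_congr_of_injective (realRand I x a k₀ ind)
    (realRand_injective I x a k₀ ind hk₀ hind)
    (realJoint_realRand P A I aux x a k₀ ind hk₀ hind hnb ha)

end Ensembles

theorem realEnsemble_eq_idealEnsemble (S : GroupGen) {N : Sizes} (A : VerifierAdversary N)
    (I : ∀ κ, Finset (Fin (N.K κ))) (k₀ : ∀ κ, Fin (N.K κ)) (hk₀ : ∀ κ, k₀ κ ∉ I κ) (κ : ℕ)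
    (aux : Fin (A.auxLen κ) → Bool) (x : Fin (N.n κ) → ZMod (S.q κ))
    (hx : (legal x).Nonempty ∨ (I κ).card + 1 = N.K κ) (pp : S.PP κ) :
    realEnsemble S A κ (I κ) aux x pp = idealEnsemble S A (A.simulator I k₀) κ (I κ) aux x pp := by
  have hx' : (legal x).Nonempty ∨ ∀ k, k ∉ I κ → k = k₀ κ := by
    -- The cardinality condition says that the complement of I is a singleton, hence {k₀}.
    refine hx.imp id fun hcard k hk => ?_
    have h1 : (I κ)ᶜ.card = 1 := by
      rw [Finset.card_compl, Fintype.card_fin]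
      omega
    exact Finset.card_le_one.mp h1.le k (Finset.mem_compl.mpr hk) _ (Finset.mem_compl.mpr (hk₀ κ))
  exact (uniform_real_eq (S.gp pp) (A.alg κ) (I κ) aux x pp.2 (k₀ κ) (hk₀ κ) hx' (N.nb_pos κ)
    pp.2.ne_zero).trans (uniform_ideal_eq (S.gp pp) (A.alg κ) (I κ) aux x pp.2 (k₀ κ)).symm

theorem theorem1 (S : GroupGen) (N : Sizes) :
    -- completeness, with error 0, and the output is distributed as that of `M_Bin`
    (∀ (κ : ℕ) (x : Fin (N.n κ) → ZMod (S.q κ)) (sh : Fin (N.K κ) → Fin (N.n κ) → ZMod (S.q κ)),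
      (∀ i, ∑ k, sh k i = x i) →
        (honestExp S N κ x sh).map (fun o => o.accept) false = 0 ∧
        (honestExp S N κ x sh).map (fun o => o.y) =
          (mBin (N.nb κ) fun k => ∑ i ∈ legal x, sh k i).map Prod.fst) ∧
    -- computational soundness
    (∀ (A : ProverAdversary N) (I : ∀ κ, Finset (Fin (N.K κ)))
      (aux : ∀ κ, Fin (A.auxLen κ) → Bool) (x : ∀ κ, Fin (N.n κ) → ZMod (S.q κ))
      (sh : ∀ κ, Fin (N.K κ) → Fin (N.n κ) → ZMod (S.q κ)),
      (∀ κ i, ∑ k, sh κ k i = x κ i) →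
        (∀ κ, (attackExp S A κ (I κ) (aux κ) (x κ) (sh κ)).map (fun o => (o.started, o.ideal)) =
          ((attackExp S A κ (I κ) (aux κ) (x κ) (sh κ)).map fun o => o.started).bind fun st =>
            (mBin (N.nb κ) fun k => ∑ i ∈ legal (x κ), sh κ k i).map fun out => (st, out.1)) ∧
        (∃ B : DLAdversary, ∀ κ,
          cheatProb S A κ (I κ) (aux κ) (x κ) (sh κ) ≤ dlAdv S B κ) ∧
        (DLHard S →
          Negligible fun κ => (cheatProb S A κ (I κ) (aux κ) (x κ) (sh κ)).toReal)) ∧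
    -- computational zero-knowledge
    (∀ (A : VerifierAdversary N) (I : ∀ κ, Finset (Fin (N.K κ))),
      (∀ κ, I κ ⊂ Finset.univ) →
        ∃ Sim : Simulator A,
          ∀ (aux : ∀ κ, Fin (A.auxLen κ) → Bool) (x : ∀ κ, Fin (N.n κ) → ZMod (S.q κ)),
            (∀ κ, (legal (x κ)).Nonempty ∨ (I κ).card + 1 = N.K κ) →
              CompIndist S
                (fun κ => Ty.joint (N.n κ) (N.nb κ) (N.K κ) (A.coins κ) (A.auxLen κ))
                (fun κ pp => realEnsemble S A κ (I κ) (aux κ) (x κ) pp)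
                (fun κ pp => idealEnsemble S A Sim κ (I κ) (aux κ) (x κ) pp)) := by

  refine ⟨fun κ x sh hsh => honest_completeness S N κ x sh hsh, fun A I aux x sh hsh =>
    ⟨fun κ => attack_correct_output S A κ (I κ) (aux κ) (x κ) (sh κ) (hsh κ),
      ⟨_, cheatProb_le S A I aux x sh hsh⟩, negligible_cheatProb S A I aux x sh hsh⟩, ?_⟩
  intro A I hI
  choose k₀ hk₀ using fun κ => Finset.exists_of_ssubset (hI κ)
  refine ⟨A.simulator I k₀, fun aux x hx E => ?_⟩
  have h : ∀ κ, realEnsemble S A κ (I κ) (aux κ) (x κ) =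
      idealEnsemble S A (A.simulator I k₀) κ (I κ) (aux κ) (x κ) := fun κ =>
    funext fun pp => realEnsemble_eq_idealEnsemble S A I k₀ (fun κ => (hk₀ κ).2) κ (aux κ) (x κ)
      (hx κ) pp
  -- The ensembles coincide for all public parameters, so every distinguisher has advantage 0.
  simp only [h, sub_self, abs_zero]
  exact Asymptotics.superpolynomialDecay_zero _ _
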